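/- **Theorem (two-volume Wegner bound).** Let $(\Omega,\mathfrak B,\mathbb P)$ be a probability space, let $(V_s)_{s\in\mathbb Z^d}$ be real random variables on it, $\varphi_s:\mathbb R^d\to\mathbb R$ ($s\in\mathbb Z^d$) measurable functions, and $U:\mathbb R^{2d}\to\mathbb R$. Let $\|\cdot\|_{\max}$ denote the maximum norm. Put $V(y;\omega)=\sum_{s\in\mathbb Z^d}V_s(\omega)\varphi_s(y-s)$ for $y\in\mathbb R^d$. For $v\in\mathbb R^d$ and $L>0$ put $\Lambda_L(v)=\prod_{i=1}^d[v^{(i)}-L,v^{(i)}+L]$, and for $\mathbf u=(u_1,u_2)\in\mathbb R^d\times\mathbb R^d$ and $L_1,L_2>0$ consider the box $\mathbf\Lambda=\mathbf\Lambda_{L_1,L_2}(\mathbf u)=\Lambda_{L_1}(u_1)\times\Lambda_{L_2}(u_2)$, with projections $\Pi_j\mathbf\Lambda=\Lambda_{L_j}(u_j)$. Let $\Sigma(H_{\mathbf\Lambda}(\omega))$ be the spectrum of the operator $H_{\mathbf\Lambda}(\omega)=-\tfrac12\Delta+U(x_1,x_2)+V(x_1;\omega)+V(x_2;\omega)$ on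 $L^2(\mathbf\Lambda)$ with Dirichlet boundary conditions. Let $\mathfrak B_{\{s\}^c}$ be the sigma-algebra generated by all $V_t$, $t\ne s$, let $F_s(y\,|\,\mathfrak B_{\{s\}^c})=\mathbb P(V_s<y\,|\,\mathfrak B_{\{s\}^c})$, and for $\epsilon>0$ put $$\nu(\epsilon)=\sup_{s\in\mathbb Z^d}\ \sup_{y\in\mathbb R}\ \operatorname{ess\,sup}\big[F_s(y+\epsilon\,|\,\mathfrak B_{\{s\}^c})-F_s(y\,|\,\mathfrak B_{\{s\}^c})\big].$$ Assume: * $U\in L^\infty(\mathbb R^{2d})$; * there is $M<\infty$ with $|V_s|\le M$ almost surely for all $s$; * the $\varphi_s$ are bounded and non-negative, and $\sup_{x\in\mathbb R^d}\sum_{s\in\mathbb Z^d}\varphi_s(x-s)<\infty$; * $\sum_{s\in\Lambda_L(v)\cap\mathbb Z^d}\varphi_s(x-s)\ge1$ for all $L\ge1$, $v\in\mathbb R^d$ and $x\in\Lambda_L(v)$; * for each $s$ the conditional distribution of $V_s$ given $\mathfrak B_{\{s\}^c}$ has a density $p_s(y;\mathfrak B_{\{s\}^c})$, and $\sup_s\sup_y\operatorname{ess\,sup}p_s(y;\mathfrak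 B_{\{s\}^c})<\infty$; * for some $R\in(0,\infty)$, $\varphi_s(y)=0$ for all $s$ and all $y$ with $\|y\|_{\max}>R$. Then for every interval $I=[a,b]\subset\mathbb R$ there is a constant $C_2(I)>0$ such that, for every $\epsilon\in(0,1)$ and all boxes $\mathbf\Lambda=\mathbf\Lambda_{L_1,L_2}(\mathbf u)$, $\mathbf\Lambda'=\mathbf\Lambda_{L_1',L_2'}(\mathbf u')$ with $L_1,L_2,L_1',L_2'>1$ that are sufficiently distant, i.e. $$\min\{\|(u_1,u_2)-\mathbf u'\|_{\max},\ \|(u_2,u_1)-\mathbf u'\|_{\max}\}>8\max\{L_1+R,\,L_2+R,\,L_1'+R,\,L_2'+R\},$$ one has $$\mathbb P\big(\operatorname{dist}[\Sigma(H_{\mathbf\Lambda})\cap I,\ \Sigma(H_{\mathbf\Lambda'})\cap I]\le\epsilon\big)\ \le\ C_2(I)\,|\mathbf\Lambda|\,|\mathbf\Lambda'|\,\max_{j=1,2}\max\big[|\Pi_j\mathbf\Lambda|,|\Pi_j\mathbf\Lambda'|\big]\,\nu(2\epsilon),$$ where $|\cdot|$ denotes Lebesgue measure (in $\mathbb R^{2d}$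 or $\mathbb R^d$) and the distance from the empty set is $+\infty$. -/

import Mathlib

open MeasureTheory Set Filter Topology
open scoped ENNReal NNReal

namespace TwoParticle

/-! ### Boxes in the two-particle configuration space -/

/-- Configurations `x = (x₁, x₂)` of two particles in `ℝ^d`. The norm on this space is the maximum
norm and its measure `volume` is Lebesgue measure on `ℝ^{2d}`. -/
abbrev Config (d : ℕ) : Type := Fin 2 → Fin d → ℝ

/-- The cube of half side `L` centred at `v` in `ℝ^d`. -/
def cube {d : ℕ} (v : Fin d → ℝ) (L : ℝ) : Set (Fin d → ℝ) :=
  {y | ∀ i, v i - L ≤ y i ∧ y i ≤ v i + L}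

/-- The two-particle box: the product of the cubes of half sides `L 0`, `L 1` centred at `u 0`,
`u 1`. -/
def box {d : ℕ} (u : Config d) (L : Fin 2 → ℝ) : Set (Config d) :=
  {x | ∀ j, x j ∈ cube (u j) (L j)}

/-- The projection of a set of configurations to the position of the particle `j`. -/
def proj {d : ℕ} (j : Fin 2) (Λ : Set (Config d)) : Set (Fin d → ℝ) :=
  (fun x : Config d => x j) '' Λ

/-- The configuration with the two particles exchanged. -/
def reflect {d : ℕ} (u : Config d) : Config d := ![u 1, u 0]

/-- The boxes `box u L` and `box u' L'` have half sides larger than `1` and are sufficiently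
distant, relative to the range `R`. -/
def SufficientlyDistant {d : ℕ} (R : ℝ) (u : Config d) (L : Fin 2 → ℝ) (u' : Config d)
    (L' : Fin 2 → ℝ) : Prop :=
  (∀ j, 1 < L j) ∧ (∀ j, 1 < L' j) ∧
    8 * max (max (L 0 + R) (L 1 + R)) (max (L' 0 + R) (L' 1 + R)) <
      min ‖u - u'‖ ‖reflect u - u'‖

/-! ### The Dirichlet realisation of a Schrödinger operator -/

/-- The complex Hilbert space `L²(Λ)`. -/
abbrev L2 {d : ℕ} (Λ : Set (Config d)) : Type := Lp ℂ 2 (volume.restrict Λ)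

/-- The unit vector of `ℝ^{2d}` in the direction of the coordinate `k = (j, i)`. -/
def unitVec {d : ℕ} (k : Fin 2 × Fin d) : Config d := Pi.single k.1 (Pi.single k.2 1)

/-- A smooth complex function with compact support in the interior of `Λ`. -/
structure IsTest {d : ℕ} (Λ : Set (Config d)) (φ : Config d → ℂ) : Prop where
  smooth : ContDiff ℝ (⊤ : ℕ∞) φ
  compact : HasCompactSupport φ
  supp : tsupport φ ⊆ interior Λ

/-- The pairs `(φ, ∇φ)` in `L²(Λ) × L²(Λ)^{2d}`, for test functions `φ` in the interior of `Λ`. -/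
noncomputable def testGraph {d : ℕ} (Λ : Set (Config d)) :
    Submodule ℂ (L2 Λ × (Fin 2 × Fin d → L2 Λ)) where
  carrier := {p | ∃ φ : Config d → ℂ, IsTest Λ φ ∧ p.1 =ᵐ[volume.restrict Λ] φ ∧
    ∀ k, p.2 k =ᵐ[volume.restrict Λ] fun x => fderiv ℝ φ x (unitVec k)}
  zero_mem' := by
    refine ⟨0, ⟨contDiff_const, HasCompactSupport.zero, by simp [tsupport]⟩, Lp.coeFn_zero _ _ _,
      fun k => ?_⟩
    filter_upwards [Lp.coeFn_zero ℂ 2 (volume.restrict Λ)] with x hx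
    simpa using hx
  add_mem' := by
    rintro p q ⟨φ, hφ, hp, hp'⟩ ⟨ψ, hψ, hq, hq'⟩
    refine ⟨φ + ψ, ⟨hφ.smooth.add hψ.smooth, hφ.compact.add hψ.compact,
      (tsupport_add φ ψ).trans (union_subset hφ.supp hψ.supp)⟩, ?_, fun k => ?_⟩
    · filter_upwards [Lp.coeFn_add p.1 q.1, hp, hq] with x h1 h2 h3
      simp only [Prod.fst_add, Pi.add_apply]
      rw [h1, Pi.add_apply, h2, h3]
    · filter_upwards [Lp.coeFn_add (p.2 k) (q.2 k), hp' k, hq' k] with x h1 h2 h3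
      have e : fderiv ℝ (φ + ψ) x = fderiv ℝ φ x + fderiv ℝ ψ x :=
        fderiv_add (hφ.smooth.differentiable (by simp) x)
          (hψ.smooth.differentiable (by simp) x)
      simp only [Prod.snd_add, Pi.add_apply, e, add_apply]
      rw [h1, Pi.add_apply, h2, h3]
  smul_mem' := by
    rintro c p ⟨φ, hφ, hp, hp'⟩
    refine ⟨c • φ, ⟨contDiff_const.smul hφ.smooth, hφ.compact.smul_left (f := fun _ => c),
      (tsupport_smul_subset_right (fun _ => c) φ).trans hφ.supp⟩, ?_, fun k => ?_⟩
    · filter_upwards [Lp.coeFn_smul c p.1, hp] with x h1 h2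
      simp only [Prod.smul_fst, Pi.smul_apply]
      rw [h1, Pi.smul_apply, h2]
    · filter_upwards [Lp.coeFn_smul c (p.2 k), hp' k] with x h1 h2
      have e : fderiv ℝ (c • φ) x = c • fderiv ℝ φ x :=
        fderiv_const_smul (hφ.smooth.differentiable (by simp) x) c
      simp only [Prod.smul_snd, Pi.smul_apply, e, smul_apply]
      rw [h1, Pi.smul_apply, h2]

/-- The pairs `(u, ∇u)` for `u` in the Sobolev space `H¹₀(Λ)`, the closure of the test functions
in the `H¹` norm. -/
noncomputable def sobolevZero {d : ℕ} (Λ : Set (Config d)) :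
    Submodule ℂ (L2 Λ × (Fin 2 × Fin d → L2 Λ)) :=
  (testGraph Λ).topologicalClosure

/-- The graph of `-½Δ + W` on `L²(Λ)` with Dirichlet boundary conditions, i.e. of the operator of
the form `½ ∫ ∇v·∇u + ∫ v W u` on `H¹₀(Λ)`: the pairs `(u, f)` with `u ∈ H¹₀(Λ)` and
`½ ⟪∇v, ∇u⟫ + ⟪v, W u⟫ = ⟪v, f⟫` for all `v ∈ H¹₀(Λ)`. -/
noncomputable def hamiltonianGraph {d : ℕ} (Λ : Set (Config d)) (W : Config d → ℝ) :
    Submodule ℂ (L2 Λ × L2 Λ) where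
  carrier := {p | ∃ (g : Fin 2 × Fin d → L2 Λ) (w : L2 Λ), (p.1, g) ∈ sobolevZero Λ ∧
    (w =ᵐ[volume.restrict Λ] fun x => (W x : ℂ) * p.1 x) ∧
    ∀ q ∈ sobolevZero Λ,
      (1 / 2 : ℂ) * ∑ k, inner ℂ (q.2 k) (g k) + inner ℂ q.1 w = inner ℂ q.1 p.2}
  zero_mem' := by
    refine ⟨0, 0, (sobolevZero Λ).zero_mem, ?_, by simp⟩
    filter_upwards [Lp.coeFn_zero ℂ 2 (volume.restrict Λ)] with x hx
    simp only [Prod.fst_zero]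
    rw [hx]
    simp
  add_mem' := by
    rintro p p' ⟨g, w, hg, hw, h⟩ ⟨g', w', hg', hw', h'⟩
    refine ⟨g + g', w + w', (sobolevZero Λ).add_mem hg hg', ?_, fun q hq => ?_⟩
    · filter_upwards [Lp.coeFn_add w w', Lp.coeFn_add p.1 p'.1, hw, hw'] with x h1 h2 h3 h4
      simp only [Prod.fst_add]
      rw [h1, h2, Pi.add_apply, Pi.add_apply, h3, h4]
      ring
    · simp only [Pi.add_apply, inner_add_right, Finset.sum_add_distrib, Prod.snd_add]
      rw [← h q hq, ← h' q hq]
      ring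
  smul_mem' := by
    rintro c p ⟨g, w, hg, hw, h⟩
    refine ⟨c • g, c • w, (sobolevZero Λ).smul_mem c hg, ?_, fun q hq => ?_⟩
    · filter_upwards [Lp.coeFn_smul c w, Lp.coeFn_smul c p.1, hw] with x h1 h2 h3
      simp only [Prod.smul_fst]
      rw [h1, h2, Pi.smul_apply, Pi.smul_apply, h3, smul_eq_mul, smul_eq_mul]
      ring
    · simp only [Pi.smul_apply, inner_smul_right, Prod.smul_snd, ← Finset.mul_sum]
      rw [← h q hq]
      ring

/-! The graph is single-valued on convex sets `Λ`, so that `hamiltonian` below has this graph. -/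

theorem convex_box {d : ℕ} (u : Config d) (L : Fin 2 → ℝ) : Convex ℝ (box u L) := by
  intro x hx y hy s t hs ht hst j i
  obtain ⟨h1, h2⟩ := hx j i
  obtain ⟨h3, h4⟩ := hy j i
  have e : (s • x + t • y) j i = s * x j i + t * y j i := rfl
  obtain rfl : t = 1 - s := by linarith
  rw [e]
  constructor <;> nlinarith

theorem IsTest.exists_mem {d : ℕ} {Λ : Set (Config d)} {φ : Config d → ℂ} (h : IsTest Λ φ) :
    ∃ p ∈ testGraph Λ, p.1 =ᵐ[volume.restrict Λ] φ ∧
      ∀ k, p.2 k =ᵐ[volume.restrict Λ] fun x => fderiv ℝ φ x (unitVec k) := by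
  have m1 : MemLp φ 2 (volume.restrict Λ) :=
    (h.smooth.continuous.memLp_of_hasCompactSupport h.compact).restrict Λ
  have m2 : ∀ k, MemLp (fun x => fderiv ℝ φ x (unitVec k)) 2 (volume.restrict Λ) := fun k =>
    (((h.smooth.continuous_fderiv (by simp)).clm_apply
      continuous_const).memLp_of_hasCompactSupport (h.compact.fderiv_apply ℝ _)).restrict Λ
  exact ⟨(m1.toLp φ, fun k => (m2 k).toLp _), ⟨φ, h, m1.coeFn_toLp, fun k => (m2 k).coeFn_toLp⟩,
    m1.coeFn_toLp, fun k => (m2 k).coeFn_toLp⟩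

theorem eq_zero_of_inner_test {d : ℕ} {Λ : Set (Config d)} (hΛ : Convex ℝ Λ) (f : L2 Λ)
    (hf : ∀ p ∈ testGraph Λ, inner ℂ p.1 f = 0) : f = 0 := by
  have hr : volume.restrict Λ = volume.restrict (interior Λ) :=
    Measure.restrict_congr_set (interior_ae_eq_of_null_frontier
      (hΛ.addHaar_frontier volume)).symm
  have hloc : LocallyIntegrable f (volume.restrict Λ) :=
    (Lp.memLp f).locallyIntegrable (by norm_num)
  have hz : ∀ᵐ x ∂(volume.restrict Λ), x ∈ interior Λ → f x = 0 := by
    refine isOpen_interior.ae_eq_zero_of_integral_contDiff_smul_eq_zero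
      (hloc.locallyIntegrableOn _) fun g hg hgc hgs => ?_
    have ht : IsTest Λ fun x => (g x : ℂ) :=
      ⟨Complex.ofRealCLM.contDiff.comp hg, hgc.comp_left Complex.ofReal_zero,
        (closure_mono (by intro x; simp)).trans hgs⟩
    obtain ⟨p, hp, hp1, -⟩ := ht.exists_mem
    rw [← hf p hp, L2.inner_def]
    refine integral_congr_ae ?_
    filter_upwards [hp1] with x hx
    rw [hx]
    simp [mul_comm]
  refine Lp.ext ?_
  have hi : ∀ᵐ x ∂(volume.restrict Λ), x ∈ interior Λ := by
    rw [hr]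
    exact ae_restrict_mem isOpen_interior.measurableSet
  filter_upwards [hz, hi, Lp.coeFn_zero ℂ 2 (volume.restrict Λ)] with x h1 h2 h3
  rw [h1 h2, h3]
  rfl

theorem inner_test_grad {d : ℕ} {Λ : Set (Config d)} {p q : L2 Λ × (Fin 2 × Fin d → L2 Λ)}
    (hp : p ∈ testGraph Λ) (hq : q ∈ sobolevZero Λ) (k : Fin 2 × Fin d) :
    inner ℂ (p.2 k) q.1 = - inner ℂ p.1 (q.2 k) := by
  have hc : IsClosed {q : L2 Λ × (Fin 2 × Fin d → L2 Λ) |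
      inner ℂ (p.2 k) q.1 = - inner ℂ p.1 (q.2 k)} :=
    isClosed_eq (by fun_prop) (by fun_prop)
  have hq' : q ∈ closure (testGraph Λ : Set (L2 Λ × (Fin 2 × Fin d → L2 Λ))) := hq
  refine closure_minimal ?_ hc hq'
  clear hq' hq q
  rintro q ⟨ψ, hψ, hq1, hq2⟩
  obtain ⟨φ, hφ, hp1, hp2⟩ := hp
  set v := unitVec k
  let χ : Config d → ℂ := fun x => (starRingEnd ℂ) (φ x)
  have hχ : ContDiff ℝ (⊤ : ℕ∞) χ := Complex.conjCLE.contDiff.comp hφ.smooth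
  have hχc : HasCompactSupport χ := hφ.compact.comp_left (map_zero _)
  have hχ' : ∀ x, fderiv ℝ χ x v = (starRingEnd ℂ) (fderiv ℝ φ x v) := fun x => by
    have hd : HasFDerivAt φ (fderiv ℝ φ x) x :=
      (hφ.smooth.differentiable (by simp) x).hasFDerivAt
    have hd' := (Complex.conjCLE : ℂ ≃L[ℝ] ℂ).hasFDerivAt.comp x hd
    have e : fderiv ℝ χ x = _ := hd'.fderiv
    rw [e]
    rfl
  have c1 := hχ.continuous
  have c2 := hψ.smooth.continuous
  have c3 : Continuous fun x => fderiv ℝ χ x v :=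
    (hχ.continuous_fderiv (by simp)).clm_apply continuous_const
  have c4 : Continuous fun x => fderiv ℝ ψ x v :=
    (hψ.smooth.continuous_fderiv (by simp)).clm_apply continuous_const
  have ibp : ∫ x, χ x * fderiv ℝ ψ x v = - ∫ x, fderiv ℝ χ x v * ψ x :=
    integral_mul_fderiv_eq_neg_fderiv_mul_of_integrable
      ((c3.mul c2).integrable_of_hasCompactSupport hψ.compact.mul_left)
      ((c1.mul c4).integrable_of_hasCompactSupport hχc.mul_right)
      ((c1.mul c2).integrable_of_hasCompactSupport hχc.mul_right)
      (fun x _ => hχ.differentiable (by simp) x)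
      (fun x _ => hψ.smooth.differentiable (by simp) x)
  have hψ0 : ∀ x, x ∉ Λ → ψ x = 0 := fun x hx =>
    image_eq_zero_of_notMem_tsupport fun h => hx (interior_subset (hψ.supp h))
  have hφ0 : ∀ x, x ∉ Λ → φ x = 0 := fun x hx =>
    image_eq_zero_of_notMem_tsupport fun h => hx (interior_subset (hφ.supp h))
  rw [← setIntegral_eq_integral_of_forall_compl_eq_zero (s := Λ)
    (fun x hx => by simp [χ, hφ0 x hx]),
    ← setIntegral_eq_integral_of_forall_compl_eq_zero (s := Λ)
    (f := fun x => fderiv ℝ χ x v * ψ x) (fun x hx => by simp [hψ0 x hx])] at ibp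
  have e1 : inner ℂ (p.2 k) q.1 = ∫ x in Λ, fderiv ℝ χ x v * ψ x := by
    rw [L2.inner_def]
    refine integral_congr_ae ?_
    filter_upwards [hp2 k, hq1] with x h1 h2
    rw [h1, h2, hχ']
    simp [v, mul_comm]
  have e2 : inner ℂ p.1 (q.2 k) = ∫ x in Λ, χ x * fderiv ℝ ψ x v := by
    rw [L2.inner_def]
    refine integral_congr_ae ?_
    filter_upwards [hp1, hq2 k] with x h1 h2
    rw [h1, h2]
    simp [v, χ, mul_comm]
  change inner ℂ (p.2 k) q.1 = - inner ℂ p.1 (q.2 k)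
  rw [e1, e2, ibp, neg_neg]

theorem hamiltonianGraph_singleValued {d : ℕ} {Λ : Set (Config d)} (hΛ : Convex ℝ Λ)
    (W : Config d → ℝ) : ∀ p ∈ hamiltonianGraph Λ W, p.1 = 0 → p.2 = 0 := by
  rintro p ⟨g, w, hg, hw, h⟩ h0
  have hw0 : w = 0 := by
    rw [h0] at hw
    refine Lp.ext ?_
    filter_upwards [hw, Lp.coeFn_zero ℂ 2 (volume.restrict Λ)] with x h1 h2
    rw [h1, h2]
    simp
  have hg0 : ∀ k, g k = 0 := fun k => eq_zero_of_inner_test hΛ _ fun q hq => by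
    have := inner_test_grad hq hg k
    simp only [h0, inner_zero_right] at this
    simpa using this.symm
  refine eq_zero_of_inner_test hΛ _ fun q hq => ?_
  rw [← h q ((testGraph Λ).le_topologicalClosure hq), hw0]
  simp [hg0]

/-- The unbounded operator `-½Δ + W` on `L²(Λ)` with Dirichlet boundary conditions. (Its graph is
`hamiltonianGraph Λ W`, which is single-valued when `Λ` is convex: see
`hamiltonianGraph_singleValued`.) -/
noncomputable def hamiltonian {d : ℕ} (Λ : Set (Config d)) (W : Config d → ℝ) :
    L2 Λ →ₗ.[ℂ] L2 Λ :=
  (hamiltonianGraph Λ W).toLinearPMap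

theorem graph_hamiltonian_box {d : ℕ} (u : Config d) (L : Fin 2 → ℝ) (W : Config d → ℝ) :
    (hamiltonian (box u L) W).graph = hamiltonianGraph (box u L) W :=
  Submodule.toLinearPMap_graph_eq _ (hamiltonianGraph_singleValued (convex_box u L) W)

/-- The resolvent set of an unbounded operator `T`: the `z` such that `T - z` maps the domain of
`T` bijectively onto the whole space, with bounded inverse. -/
def resolventSetOf {E : Type*} [NormedAddCommGroup E] [NormedSpace ℂ E] (T : E →ₗ.[ℂ] E) : Set ℂ :=
  {z | ∃ S : E →L[ℂ] E, (∀ y, ∃ x : T.domain, (x : E) = S y ∧ T x - z • (x : E) = y) ∧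
    ∀ x : T.domain, S (T x - z • (x : E)) = x}

/-- The spectrum of an unbounded operator `T` (its real part as a subset of `ℝ`; the operators
considered here are self-adjoint, so that this is all of it). -/
def realSpectrum {E : Type*} [NormedAddCommGroup E] [NormedSpace ℂ E] (T : E →ₗ.[ℂ] E) : Set ℝ :=
  {t | (t : ℂ) ∉ resolventSetOf T}

/-- The distance of two sets of reals, `∞` if one of them is empty. -/
noncomputable def setDist (A B : Set ℝ) : ℝ≥0∞ := ⨅ x ∈ A, ⨅ y ∈ B, edist x y

/-! ### The alloy-type random potential -/

/-- The lattice point `s ∈ ℤ^d` as a point of `ℝ^d`. -/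
def latticePt {d : ℕ} (s : Fin d → ℤ) : Fin d → ℝ := fun i => (s i : ℝ)

/-- The one-particle potential `∑ₛ Vₛ φₛ(y - s)` with amplitudes `Vₛ = v s`. -/
noncomputable def alloy {d : ℕ} (φ : (Fin d → ℤ) → (Fin d → ℝ) → ℝ) (v : (Fin d → ℤ) → ℝ)
    (y : Fin d → ℝ) : ℝ :=
  ∑' s, v s * φ s (y - latticePt s)

/-- The spectrum of `H_Λ = -½Δ + U(x) + V(x₁) + V(x₂)` on `L²(Λ)` with Dirichlet boundary
conditions, where `V` is the alloy potential with amplitudes `v`. -/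
noncomputable def boxSpectrum {d : ℕ} (U : Config d → ℝ) (φ : (Fin d → ℤ) → (Fin d → ℝ) → ℝ)
    (v : (Fin d → ℤ) → ℝ) (Λ : Set (Config d)) : Set ℝ :=
  realSpectrum (hamiltonian Λ fun x => U x + ∑ j, alloy φ v (x j))

section Random

variable {d : ℕ} {Ω : Type*}

/-- The sigma-algebra generated by the random variables `V t`, `t ≠ s`. -/
abbrev offSite (V : (Fin d → ℤ) → Ω → ℝ) (s : Fin d → ℤ) : MeasurableSpace Ω :=
  ⨆ t : {t // t ≠ s}, MeasurableSpace.comap (V t) inferInstance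

variable [MeasurableSpace Ω]

/-- The conditional distribution function `ω ↦ P(V s < y | V t, t ≠ s)`. -/
noncomputable def condCdf (P : Measure Ω) (V : (Fin d → ℤ) → Ω → ℝ) (s : Fin d → ℤ) (y : ℝ) :
    Ω → ℝ :=
  condExp (offSite V s) P ((V s ⁻¹' Iio y).indicator fun _ => (1 : ℝ))

/-- The modulus of continuity
`ν(ε) = sup_s sup_y ess sup [F_s(y + ε | V t, t ≠ s) - F_s(y | V t, t ≠ s)]`. -/
noncomputable def condModulus (P : Measure Ω) (V : (Fin d → ℤ) → Ω → ℝ) (ε : ℝ) : ℝ≥0∞ :=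
  ⨆ (s : Fin d → ℤ) (y : ℝ),
    essSup (fun ω => ENNReal.ofReal (condCdf P V s (y + ε) ω - condCdf P V s y ω)) P

/-- The random amplitudes are uniformly bounded, almost surely. -/
def BoundedField (P : Measure Ω) (V : (Fin d → ℤ) → Ω → ℝ) : Prop :=
  ∃ M : ℝ, ∀ s, ∀ᵐ ω ∂P, |V s ω| ≤ M

/-- The conditional distribution of each `V s` given all `V t`, `t ≠ s`, has a probability density
`p`, and these densities are bounded uniformly in the site, the point and the condition. -/
def UniformMarginalControl (P : Measure Ω) (V : (Fin d → ℤ) → Ω → ℝ) : Prop :=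
  ∃ ρ : ℝ≥0, ∀ s, ∃ p : Ω → ℝ → ℝ≥0∞,
    Measurable[(offSite V s).prod (borel ℝ)] (Function.uncurry p) ∧
    (∀ y, (fun ω => ENNReal.ofReal (condCdf P V s y ω)) =ᵐ[P] fun ω => ∫⁻ t in Iio y, p ω t) ∧
    ∀ y, ∀ᵐ ω ∂P, p ω y ≤ ρ

end Random

/-- The bumps are bounded, non-negative (measurable) functions, and `∑ₛ φₛ(x - s)` is bounded
uniformly in `x`. -/
def BoundedBumps {d : ℕ} (φ : (Fin d → ℤ) → (Fin d → ℝ) → ℝ) : Prop :=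
  (∀ s, Measurable (φ s) ∧ (∀ y, 0 ≤ φ s y) ∧ ∃ B : ℝ, ∀ y, φ s y ≤ B) ∧
    ∃ K : ℝ≥0, ∀ x, ∑' s, ENNReal.ofReal (φ s (x - latticePt s)) ≤ K

/-- The covering condition: in each cube of half side at least `1`, the bumps of the lattice points
of the cube add up to at least `1`. -/
def Covering {d : ℕ} (φ : (Fin d → ℤ) → (Fin d → ℝ) → ℝ) : Prop :=
  ∀ L : ℝ, 1 ≤ L → ∀ u : Fin d → ℝ, ∀ x ∈ cube u L,
    1 ≤ ∑' s : {s : Fin d → ℤ // latticePt s ∈ cube u L}, φ s (x - latticePt s)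

/-- The bumps have range at most `R` (in the maximum norm). -/
def FiniteRange {d : ℕ} (φ : (Fin d → ℤ) → (Fin d → ℝ) → ℝ) (R : ℝ) : Prop :=
  ∀ s y, R < ‖y‖ → φ s y = 0

end TwoParticle

/-! The spectrum of a box Hamiltonian below a fixed energy consists of min-max values `level k`,
which are deterministic functions of the amplitudes. At most a multiple of the volume of the box of
them lie below that energy (`exists_level_count`). If the two spectra come within `ε` of each other
in `I`, some pair of levels, one for each box, differs by less than `2 * ε`. A union bound over
these pairs produces the factor `|Λ| |Λ'|`, and it remains to treat a single pair.

By the distance condition, one projection of one box, a cube `Q`, is so far from both projections of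
the other box that the amplitudes at the sites of `Q` do not enter the potential of the other box
(`SufficientlyDistant.exists_far`). Lowering these amplitudes by `η` leaves the levels of the other
box alone. By the covering condition it lowers the levels of the first box by at least `η`. The
difference of the two levels is therefore monotone in the amplitudes on `Q` and drops by at least
`η` under the shift. Stollmann's argument, carried out conditionally one site at a time
(`measure_Ioc_le`), bounds the probability that it falls in an interval of length `η` by `2 |S|
ν(η)`, where `S` is the set of sites of `Q` and `|S|` is at most a multiple of the volume of `Q`.

The link between spectrum and levels (`exists_level_eq_of_mem_spectrum`) is made through forms on
the Hilbert space `H¹₀`: if `t` is not a level, the bounded operator of the form minus `t` is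
invertible, and its inverse yields the resolvent. The count comes from a Poincaré inequality on the
cells of a fine grid. -/

namespace TwoParticle

/-! ### Min-max levels of a quadratic form -/

section Levels

variable {D H : Type*} [NormedAddCommGroup D] [InnerProductSpace ℂ D]
  [NormedAddCommGroup H] [InnerProductSpace ℂ H]

/-- The reals `t` such that the form `q` is at most `t ‖J u‖²` on a subspace of dimension
`k + 1`. The infimum of this set is the `k`-th min-max value of `q`. -/
def formLevels (q : D → ℝ) (J : D →L[ℂ] H) (k : ℕ) : Set ℝ :=
  {t | ∃ F : Submodule ℂ D, Module.finrank ℂ F = k + 1 ∧ ∀ u ∈ F, q u ≤ t * ‖J u‖ ^ 2}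

theorem formLevels_upward {q : D → ℝ} {J : D →L[ℂ] H} {k : ℕ} {t t' : ℝ} (htt : t ≤ t')
    (ht : t ∈ formLevels q J k) : t' ∈ formLevels q J k := by
  obtain ⟨F, hF, h⟩ := ht
  refine ⟨F, hF, fun u hu => (h u hu).trans ?_⟩
  gcongr

theorem formLevels_shift {q q' : D → ℝ} {J : D →L[ℂ] H} {k : ℕ} {t c : ℝ}
    (hq : ∀ u, q u ≤ q' u + c * ‖J u‖ ^ 2) (ht : t ∈ formLevels q' J k) :
    t + c ∈ formLevels q J k := by
  obtain ⟨F, hF, h⟩ := ht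
  refine ⟨F, hF, fun u hu => ?_⟩
  have h1 := hq u
  have h2 := h u hu
  nlinarith

theorem formLevels_bddBelow {q : D → ℝ} {J : D →L[ℂ] H} {c m : ℝ} (hc : 0 < c)
    (hq : ∀ u, c * ‖u‖ ^ 2 ≤ q u + m * ‖J u‖ ^ 2) (k : ℕ) :
    BddBelow (formLevels q J k) := by
  refine ⟨-m, fun t ht => ?_⟩
  obtain ⟨F, hF, h⟩ := ht
  have : Nontrivial F := Module.nontrivial_of_finrank_pos (R := ℂ) (by omega)
  obtain ⟨⟨u, hu⟩, hu0⟩ := exists_ne (0 : F)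
  have hn : 0 < ‖u‖ := norm_pos_iff.2 fun h => hu0 (by simpa using h)
  by_contra! hlt
  have h1 := hq u
  have h2 := h u hu
  have h3 : (t + m) * ‖J u‖ ^ 2 ≤ 0 := mul_nonpos_of_nonpos_of_nonneg (by linarith) (by positivity)
  have h4 : 0 < c * ‖u‖ ^ 2 := by positivity
  linarith

theorem sInf_formLevels_le {q q' : D → ℝ} {J : D →L[ℂ] H} {k : ℕ} {c : ℝ}
    (hb : BddBelow (formLevels q J k)) (hne : (formLevels q' J k).Nonempty)
    (hq : ∀ u, q u ≤ q' u + c * ‖J u‖ ^ 2) :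
    sInf (formLevels q J k) ≤ sInf (formLevels q' J k) + c := by
  have : sInf (formLevels q J k) - c ≤ sInf (formLevels q' J k) :=
    le_csInf hne fun t ht => by
      have := csInf_le hb (formLevels_shift hq ht)
      linarith
  linarith

/-- The lower bound gives injectivity and closed range; self-adjointness makes the orthogonal
complement of the range equal to the kernel, which is zero. -/
theorem isUnit_of_isSelfAdjoint_of_bound [CompleteSpace D] {B : D →L[ℂ] D}
    (hB : IsSelfAdjoint B) {c : ℝ} (hc : 0 < c) (h : ∀ u, c * ‖u‖ ≤ ‖B u‖) : IsUnit B := by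
  have hanti : AntilipschitzWith (Real.toNNReal c⁻¹) B :=
    AddMonoidHomClass.antilipschitz_of_bound B fun u => by
      rw [Real.coe_toNNReal _ (by positivity), ← div_eq_inv_mul, le_div_iff₀' hc]
      exact h u
  have hcl : IsClosed (B.range : Set D) := by
    rw [LinearMap.coe_range]
    exact hanti.isClosed_range B.uniformContinuous
  have hinj : Function.Injective B := hanti.injective
  rw [ContinuousLinearMap.isUnit_iff_bijective]
  refine ⟨hinj, ?_⟩
  have hadj : ContinuousLinearMap.adjoint B = B := hB.adjoint_eq
  have horth : (B.range)ᗮ = ⊥ := by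
    rw [ContinuousLinearMap.orthogonal_range, hadj]
    exact LinearMap.ker_eq_bot.2 hinj
  have : CompleteSpace B.range := hcl.completeSpace_coe
  have htop : B.range = ⊤ := (Submodule.orthogonal_eq_bot_iff).1 horth
  exact LinearMap.range_eq_top.1 htop

/-- `F` need not be invariant under `B`, so the complement is taken with respect to the form. The
compression of `B` to `F` is injective because its form is negative definite, hence surjective by
finite dimension; this solves for `f`. -/
theorem exists_add_of_form_neg {B : D →L[ℂ] D} {F : Submodule ℂ D} [FiniteDimensional ℂ F]
    (hF : ∀ f ∈ F, f ≠ 0 → (inner ℂ f (B f)).re < 0) (u : D) :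
    ∃ f ∈ F, ∃ w, u = f + w ∧ ∀ g ∈ F, inner ℂ g (B w) = 0 := by
  let β : F →ₗ[ℂ] F :=
    (F.orthogonalProjectionOnto : D →ₗ[ℂ] F) ∘ₗ (B : D →ₗ[ℂ] D) ∘ₗ F.subtype
  have hβ : ∀ (g f : F), inner ℂ g (β f) = inner ℂ (g : D) (B f) := fun g f => by
    simp [β]
  have hinj : Function.Injective β := by
    rw [← LinearMap.ker_eq_bot, LinearMap.ker_eq_bot']
    intro f hf
    by_contra h0
    have := hF f f.2 (by simpa using h0)
    rw [← hβ, hf] at this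
    simp at this
  obtain ⟨f, hf⟩ := (LinearMap.injective_iff_surjective.1 hinj) (F.orthogonalProjectionOnto (B u))
  refine ⟨f, f.2, u - f, by abel, fun g hg => ?_⟩
  have h1 := hβ ⟨g, hg⟩ f
  rw [hf] at h1
  have h2 : inner ℂ (⟨g, hg⟩ : F) (F.orthogonalProjectionOnto (B u)) = inner ℂ g (B u) := by
    simp
  rw [map_sub, inner_sub_right, ← h1, h2, sub_self]

/-- On the form complement of a subspace on which `B` is negative, and which is of maximal dimension
with this property up to a small error, the form of `B` is positive. -/
theorem form_pos_of_maximal {B : D →L[ℂ] D} {J : D →L[ℂ] H} {F : Submodule ℂ D} {n : ℕ} {δ η : ℝ}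
    [FiniteDimensional ℂ F] (hB : ∀ u v, inner ℂ u (B v) = inner ℂ (B u) v)
    (hn : Module.finrank ℂ F = n) (hη : 0 < η) (hδ : 2 * η ≤ δ)
    (hF : ∀ f ∈ F, (inner ℂ f (B f)).re ≤ -δ * ‖J f‖ ^ 2)
    (hmax : 2 * η ∉ formLevels (fun u => (inner ℂ u (B u)).re) J n) {w : D}
    (hw : ∀ f ∈ F, inner ℂ f (B w) = 0) : η * ‖J w‖ ^ 2 ≤ (inner ℂ w (B w)).re := by
  by_contra! hlt
  have hwF : w ∉ F := fun h => by
    have h1 := hF w h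
    rw [hw w h, Complex.zero_re] at hlt h1
    nlinarith
  have hw0 : w ≠ 0 := by
    rintro rfl
    exact hwF F.zero_mem
  -- If the form were too small at `w`, adjoining `w` to `F` would give dimension `n + 1` with form
  -- at most `2 * η * ‖J ·‖ ^ 2`, which `hmax` excludes.
  refine hmax ⟨F ⊔ Submodule.span ℂ {w}, ?_, ?_⟩
  · have h1 := Submodule.finrank_sup_add_finrank_inf_eq F (Submodule.span ℂ {w})
    have h2 : F ⊓ Submodule.span ℂ {w} = ⊥ :=
      ((Submodule.disjoint_span_singleton' hw0).2 hwF).eq_bot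
    rw [h2, finrank_bot, finrank_span_singleton hw0, hn] at h1
    omega
  · intro u hu
    obtain ⟨f, hf, w', hw', rfl⟩ := Submodule.mem_sup.1 hu
    obtain ⟨z, rfl⟩ := Submodule.mem_span_singleton.1 hw'
    set x := z • w with hx
    have hx0 : ∀ f ∈ F, inner ℂ f (B x) = 0 := fun f hf => by
      rw [hx, map_smul, inner_smul_right, hw f hf, mul_zero]
    have hxf : inner ℂ x (B f) = 0 := by
      rw [hB, ← inner_conj_symm, hx0 f hf, map_zero]
    have hxx : (inner ℂ x (B x)).re ≤ η * ‖J x‖ ^ 2 := by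
      have e : inner ℂ x (B x) = ((‖z‖ ^ 2 : ℝ) : ℂ) * inner ℂ w (B w) := by
        rw [hx, map_smul, inner_smul_right, inner_smul_left, ← mul_assoc, Complex.mul_conj,
          Complex.normSq_eq_norm_sq]
      rw [e, Complex.re_ofReal_mul, hx, map_smul, norm_smul, mul_pow]
      have := sq_nonneg ‖z‖
      nlinarith
    have hff := hF f hf
    have hsum : (inner ℂ (f + x) (B (f + x))).re
        = (inner ℂ f (B f)).re + (inner ℂ x (B x)).re := by
      rw [map_add, inner_add_left, inner_add_right, inner_add_right, hx0 f hf, hxf]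
      simp
    have htri : ‖J x‖ ≤ ‖J (f + x)‖ + ‖J f‖ := by
      have : J x = J (f + x) - J f := by simp
      rw [this]
      exact norm_sub_le _ _
    -- The vectors `J x` and `J f` need not be orthogonal. The resulting error `2 * η * ‖J f‖ ^ 2`
    -- is absorbed by the negative form on `F`, since `2 * η ≤ δ`; this is the source of the level
    -- `2 * η`.
    have hsq : ‖J x‖ ^ 2 ≤ 2 * ‖J (f + x)‖ ^ 2 + 2 * ‖J f‖ ^ 2 := by
      have := norm_nonneg (J x)
      nlinarith [sq_nonneg (‖J (f + x)‖ - ‖J f‖)]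
    change (inner ℂ (f + x) (B (f + x))).re ≤ _
    rw [hsum]
    have := sq_nonneg ‖J f‖
    nlinarith

/-- Split `u = f + w` along `F` and its form complement and test `B u` against `w - f`. The cross
terms cancel, and what remains is the form at `w` minus the form at `f`. Both parts are coercive, so
`B` is bounded below. -/
theorem isUnit_of_form_gap [CompleteSpace D] {B : D →L[ℂ] D} {J : D →L[ℂ] H}
    {F : Submodule ℂ D} {n : ℕ} {δ η c m : ℝ} [FiniteDimensional ℂ F] (hB : IsSelfAdjoint B)
    (hc : 0 < c) (hq : ∀ u, c * ‖u‖ ^ 2 ≤ (inner ℂ u (B u)).re + m * ‖J u‖ ^ 2)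
    (hn : Module.finrank ℂ F = n) (hη : 0 < η) (hδ : 2 * η ≤ δ)
    (hF : ∀ f ∈ F, (inner ℂ f (B f)).re ≤ -δ * ‖J f‖ ^ 2)
    (hmax : 2 * η ∉ formLevels (fun u => (inner ℂ u (B u)).re) J n) : IsUnit B := by
  have hsymm : ∀ u v, inner ℂ u (B v) = inner ℂ (B u) v := fun u v => by
    conv_rhs => rw [← hB.adjoint_eq, ContinuousLinearMap.adjoint_inner_left]
  have hm0 : 0 ≤ |m| / η := by positivity
  have hmm : |m| / η * η = |m| := div_mul_cancel₀ _ hη.ne'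
  -- A form bounded below by `η * ‖J ·‖ ^ 2` absorbs the term `m * ‖J ·‖ ^ 2` of `hq` at the cost of
  -- the factor `C`.
  set C := 1 + |m| / η with hC
  have hfC : ∀ f ∈ F, c * ‖f‖ ^ 2 ≤ C * -(inner ℂ f (B f)).re := fun f hf => by
    have h1 := hq f
    have h2 := hF f hf
    have h3 : m * ‖J f‖ ^ 2 ≤ |m| * ‖J f‖ ^ 2 := by gcongr; exact le_abs_self m
    have h4 : η * ‖J f‖ ^ 2 ≤ -(inner ℂ f (B f)).re := by nlinarith [sq_nonneg ‖J f‖]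
    have h5 := mul_le_mul_of_nonneg_left h4 hm0
    rw [← mul_assoc, hmm] at h5
    have h6 : 0 ≤ η * ‖J f‖ ^ 2 := by positivity
    rw [hC]
    linarith
  have hneg : ∀ f ∈ F, f ≠ 0 → (inner ℂ f (B f)).re < 0 := fun f hf h0 => by
    have h1 := hfC f hf
    have h2 : 0 < c * ‖f‖ ^ 2 := by
      have := norm_pos_iff.2 h0
      positivity
    by_contra! h3
    have : C * -(inner ℂ f (B f)).re ≤ 0 :=
      mul_nonpos_of_nonneg_of_nonpos (by positivity) (by linarith)
    linarith
  have hCpos : 0 < C := by positivity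
  refine isUnit_of_isSelfAdjoint_of_bound hB (c := c / (2 * C)) (by positivity) fun u => ?_
  obtain ⟨f, hf, w, rfl, hw⟩ := exists_add_of_form_neg hneg u
  have h1 := hfC f hf
  have h2 : c * ‖w‖ ^ 2 ≤ C * (inner ℂ w (B w)).re := by
    have h1 := hq w
    have h3 : m * ‖J w‖ ^ 2 ≤ |m| * ‖J w‖ ^ 2 := by gcongr; exact le_abs_self m
    have h4 := form_pos_of_maximal hsymm hn hη hδ hF hmax hw
    have h5 := mul_le_mul_of_nonneg_left h4 hm0
    rw [← mul_assoc, hmm] at h5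
    rw [hC]
    linarith
  have hwf : inner ℂ w (B f) = 0 := by
    rw [hsymm, ← inner_conj_symm, hw f hf, map_zero]
  have h3 : (inner ℂ (w - f) (B (f + w))).re = (inner ℂ w (B w)).re - (inner ℂ f (B f)).re := by
    rw [map_add, inner_sub_left, inner_add_right, inner_add_right, hwf, hw f hf]
    simp
  have h4 : (inner ℂ (w - f) (B (f + w))).re ≤ (‖w‖ + ‖f‖) * ‖B (f + w)‖ :=
    (Complex.re_le_norm _).trans ((norm_inner_le_norm _ _).trans (by
      gcongr
      exact norm_sub_le _ _))
  set β := ‖B (f + w)‖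
  have hβ : 0 ≤ β := norm_nonneg _
  have h5 : c * (‖f‖ ^ 2 + ‖w‖ ^ 2) ≤ C * ((‖w‖ + ‖f‖) * β) := by
    have := mul_le_mul_of_nonneg_left h4 hCpos.le
    rw [h3] at this
    linarith
  have h6 : c * (‖f‖ + ‖w‖) ^ 2 ≤ 2 * C * (‖f‖ + ‖w‖) * β := by
    nlinarith [mul_nonneg hc.le (sq_nonneg (‖f‖ - ‖w‖))]
  rw [div_mul_eq_mul_div, div_le_iff₀ (by positivity)]
  have h7 : ‖f + w‖ ≤ ‖f‖ + ‖w‖ := norm_add_le _ _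
  rcases (add_nonneg (norm_nonneg f) (norm_nonneg w)).eq_or_lt' with h0 | h0
  · have : ‖f + w‖ ≤ 0 := by linarith
    have h8 : c * ‖f + w‖ ≤ 0 := mul_nonpos_of_nonneg_of_nonpos hc.le this
    nlinarith [mul_nonneg hβ hCpos.le]
  · have h8 : c * (‖f‖ + ‖w‖) ≤ 2 * C * β := by
      refine le_of_mul_le_mul_right ?_ h0
      linarith
    have := mul_le_mul_of_nonneg_left h7 hc.le
    linarith

/-- The spectrum of a self-adjoint operator, given by its quadratic form, consists of min-max values
below a bound under which there are finitely many of them. -/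
theorem exists_level_eq_of_not_isUnit [CompleteSpace D] [CompleteSpace H] {A : D →L[ℂ] D}
    (hA : IsSelfAdjoint A) {J : D →L[ℂ] H} {c m b t : ℝ} {N : ℕ} (hc : 0 < c)
    (hq : ∀ u, c * ‖u‖ ^ 2 ≤ (inner ℂ u (A u)).re + m * ‖J u‖ ^ 2)
    (hN : ∀ k, ∀ t' ∈ formLevels (fun u => (inner ℂ u (A u)).re) J k, t' ≤ b + 1 → k < N)
    (htb : t ≤ b)
    (hns : ¬ IsUnit (A - (t : ℂ) • (ContinuousLinearMap.adjoint J ∘L J))) :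
    ∃ k < N, (formLevels (fun u => (inner ℂ u (A u)).re) J k).Nonempty ∧
      sInf (formLevels (fun u => (inner ℂ u (A u)).re) J k) = t := by
  classical
  set q : D → ℝ := fun u => (inner ℂ u (A u)).re with hqd
  set B := A - (t : ℂ) • (ContinuousLinearMap.adjoint J ∘L J) with hBd
  have hBq : ∀ u, (inner ℂ u (B u)).re = q u - t * ‖J u‖ ^ 2 := fun u => by
    simp only [hBd, sub_apply, smul_apply,
      ContinuousLinearMap.comp_apply, inner_sub_right, inner_smul_right,
      ContinuousLinearMap.adjoint_inner_right, inner_self_eq_norm_sq_to_K, Complex.sub_re, hqd]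
    congr 1
    norm_cast
    rw [Complex.re_ofReal_mul]
    rfl
  have hBsa : IsSelfAdjoint B := by
    refine hA.sub (IsSelfAdjoint.smul (by simp [IsSelfAdjoint]) ?_)
    rw [isSelfAdjoint_iff, ContinuousLinearMap.star_eq_adjoint, ContinuousLinearMap.adjoint_comp,
      ContinuousLinearMap.adjoint_adjoint]
  -- The largest `n` with `Q n` counts the levels strictly below `t`. The level with index `n` is
  -- then at least `t` by maximality, and at most `t` because otherwise there would be a gap around
  -- `t`.
  let Q : ℕ → Prop := fun n => ∃ δ > 0, ∃ F : Submodule ℂ D, FiniteDimensional ℂ F ∧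
    Module.finrank ℂ F = n ∧ ∀ u ∈ F, q u ≤ (t - δ) * ‖J u‖ ^ 2
  have hQ0 : Q 0 := ⟨1, one_pos, ⊥, inferInstance, by simp, by simp [hqd]⟩
  have hQN : ∀ n, Q n → n ≤ N := by
    rintro (_ | k) ⟨δ, hδ, F, -, hF, h⟩
    · exact zero_le
    · exact hN k (t - δ) ⟨F, hF, h⟩ (by linarith)
  set n := Nat.findGreatest Q N
  have hn : Q n := Nat.findGreatest_spec zero_le hQ0
  have hn1 : ¬ Q (n + 1) := fun h =>
    Nat.findGreatest_is_greatest (lt_add_one n) (hQN _ h) h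
  have hlow : ∀ δ > 0, t - δ ∉ formLevels q J n := fun δ hδ => by
    rintro ⟨F, hF, h⟩
    exact hn1 ⟨δ, hδ, F, Module.finite_of_finrank_pos (by omega), hF, h⟩
  obtain ⟨δ, hδ, F, hfin, hF, hFq⟩ := hn
  have hup : ∀ ε > 0, t + ε ∈ formLevels q J n := fun ε hε => by
    by_contra hnot
    set η := min (δ / 2) (ε / 2)
    have hη : 0 < η := by positivity
    have h1 : 2 * η ≤ δ := by linarith [min_le_left (δ / 2) (ε / 2)]
    have h2 : 2 * η ≤ ε := by linarith [min_le_right (δ / 2) (ε / 2)]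
    refine hns (isUnit_of_form_gap hBsa (J := J) (m := m + t) hc (fun u => ?_) hF hη h1
      (fun f hf => ?_) fun h => hnot ?_)
    · rw [hBq]
      linarith [hq u]
    · rw [hBq]
      linarith [hFq f hf]
    · refine formLevels_upward (by linarith : t + 2 * η ≤ t + ε) ?_
      rw [add_comm]
      exact formLevels_shift (fun u => by rw [hBq]; linarith) h
  have hne : (formLevels q J n).Nonempty := ⟨_, hup 1 one_pos⟩
  -- Only numbers above `t` are known to belong to the level set; `t + 1` is one of them, whence the
  -- bound `b + 1` in `hN`.
  refine ⟨n, hN n (t + 1) (hup 1 one_pos) (by linarith), hne, le_antisymm ?_ ?_⟩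
  · exact le_of_forall_pos_le_add fun ε hε => csInf_le (formLevels_bddBelow hc hq n) (hup ε hε)
  · refine le_csInf hne fun s hs => ?_
    by_contra! hlt
    exact hlow (t - s) (by linarith) (by simpa using hs)

end Levels

/-! ### The Sobolev space as a Hilbert space -/

section Sobolev

variable {d : ℕ} {Λ : Set (Config d)}

/-- The `ℓ²` product of `L²(Λ)` and `L²(Λ)^{2d}`. -/
abbrev PairSpace (Λ : Set (Config d)) : Type :=
  WithLp 2 (L2 Λ × PiLp 2 fun _ : Fin 2 × Fin d => L2 Λ)

/-- The projection to `L²(Λ)`. -/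
noncomputable def pairFst (Λ : Set (Config d)) : PairSpace Λ →L[ℂ] L2 Λ :=
  WithLp.fstL 2 ℂ _ _

/-- The projections to the factors of `L²(Λ)^{2d}`. -/
noncomputable def pairSnd (Λ : Set (Config d)) (k : Fin 2 × Fin d) : PairSpace Λ →L[ℂ] L2 Λ :=
  PiLp.proj 2 (fun _ : Fin 2 × Fin d => L2 Λ) k ∘L WithLp.sndL 2 ℂ _ _

/-- The identification of the `ℓ²` product with the product. -/
noncomputable def pairMap (Λ : Set (Config d)) : PairSpace Λ →L[ℂ] L2 Λ × (Fin 2 × Fin d → L2 Λ) :=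
  (pairFst Λ).prod (ContinuousLinearMap.pi (pairSnd Λ))

/-- The Sobolev space `H¹₀(Λ)` as a subspace of the `ℓ²` product. -/
noncomputable def sobolevHilbert (Λ : Set (Config d)) : Submodule ℂ (PairSpace Λ) :=
  (sobolevZero Λ).comap (pairMap Λ).toLinearMap

theorem isClosed_sobolevHilbert (Λ : Set (Config d)) :
    IsClosed (sobolevHilbert Λ : Set (PairSpace Λ)) :=
  (Submodule.isClosed_topologicalClosure (testGraph Λ)).preimage (pairMap Λ).continuous

/-- The Sobolev space `H¹₀(Λ)`, with its Hilbert space structure. -/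
def SobolevSpace (Λ : Set (Config d)) : Type := sobolevHilbert Λ

noncomputable instance : NormedAddCommGroup (SobolevSpace Λ) :=
  inferInstanceAs (NormedAddCommGroup (sobolevHilbert Λ))

noncomputable instance : InnerProductSpace ℂ (SobolevSpace Λ) :=
  inferInstanceAs (InnerProductSpace ℂ (sobolevHilbert Λ))

instance : CompleteSpace (SobolevSpace Λ) :=
  (isClosed_sobolevHilbert Λ).completeSpace_coe

/-- The inclusion of `H¹₀(Λ)` into `L²(Λ) × L²(Λ)^{2d}`. -/
noncomputable def sobolevIncl (Λ : Set (Config d)) : SobolevSpace Λ →L[ℂ] PairSpace Λ :=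
  (sobolevHilbert Λ).subtypeL

/-- The inclusion of `H¹₀(Λ)` into `L²(Λ)`. -/
noncomputable def sobolevVal (Λ : Set (Config d)) : SobolevSpace Λ →L[ℂ] L2 Λ :=
  pairFst Λ ∘L sobolevIncl Λ

/-- The partial derivatives on `H¹₀(Λ)`. -/
noncomputable def sobolevGrad (Λ : Set (Config d)) (k : Fin 2 × Fin d) :
    SobolevSpace Λ →L[ℂ] L2 Λ :=
  pairSnd Λ k ∘L sobolevIncl Λ

theorem sobolev_norm_sq (u : SobolevSpace Λ) :
    ‖u‖ ^ 2 = ‖sobolevVal Λ u‖ ^ 2 + ∑ k, ‖sobolevGrad Λ k u‖ ^ 2 := by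
  change ‖sobolevIncl Λ u‖ ^ 2 = _
  rw [WithLp.prod_norm_sq_eq_of_L2, PiLp.norm_sq_eq_of_L2]
  rfl

theorem sobolev_mem (u : SobolevSpace Λ) :
    (sobolevVal Λ u, fun k => sobolevGrad Λ k u) ∈ sobolevZero Λ := u.2

theorem exists_sobolev_eq {p : L2 Λ × (Fin 2 × Fin d → L2 Λ)} (hp : p ∈ sobolevZero Λ) :
    ∃ u, sobolevVal Λ u = p.1 ∧ ∀ k, sobolevGrad Λ k u = p.2 k :=
  ⟨(⟨WithLp.toLp 2 (p.1, WithLp.toLp 2 p.2), hp⟩ : sobolevHilbert Λ), rfl, fun _ => rfl⟩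

/-! ### Bounded potentials and the energy form on `H¹₀` -/

/-- Multiplication by an essentially bounded real function, as an operator on `L²(Λ)`. -/
noncomputable def mulOp {W : Config d → ℝ} (hW : MemLp W ⊤ (volume.restrict Λ)) :
    L2 Λ →L[ℂ] L2 Λ :=
  (ContinuousLinearMap.mul ℂ ℂ).holderL (volume.restrict Λ) ⊤ 2 2
    ((hW.ofReal : MemLp (fun x => (W x : ℂ)) ⊤ (volume.restrict Λ)).toLp _)

theorem mulOp_coeFn {W : Config d → ℝ} (hW : MemLp W ⊤ (volume.restrict Λ)) (f : L2 Λ) :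
    mulOp hW f =ᵐ[volume.restrict Λ] fun x => (W x : ℂ) * f x := by
  have h1 := (ContinuousLinearMap.mul ℂ ℂ).coeFn_holder (r := 2)
    ((hW.ofReal : MemLp (fun x => (W x : ℂ)) ⊤ (volume.restrict Λ)).toLp _) f
  have h2 := (hW.ofReal : MemLp (fun x => (W x : ℂ)) ⊤ (volume.restrict Λ)).coeFn_toLp
  filter_upwards [h1, h2] with x h3 h4
  refine h3.trans ?_
  rw [h4]
  rfl

theorem mulOp_inner {W : Config d → ℝ} (hW : MemLp W ⊤ (volume.restrict Λ)) (f g : L2 Λ) :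
    inner ℂ f (mulOp hW g) = inner ℂ (mulOp hW f) g := by
  rw [L2.inner_def, L2.inner_def]
  refine integral_congr_ae ?_
  filter_upwards [mulOp_coeFn hW f, mulOp_coeFn hW g] with x h1 h2
  rw [h1, h2]
  simp
  ring

theorem mulOp_inner_re {W : Config d → ℝ} (hW : MemLp W ⊤ (volume.restrict Λ)) (f : L2 Λ) :
    (inner ℂ f (mulOp hW f)).re = ∫ x in Λ, W x * ‖f x‖ ^ 2 := by
  have : inner ℂ f (mulOp hW f) = ∫ x in Λ, ((W x * ‖f x‖ ^ 2 : ℝ) : ℂ) := by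
    rw [L2.inner_def]
    refine integral_congr_ae ?_
    filter_upwards [mulOp_coeFn hW f] with x h1
    rw [h1, RCLike.inner_apply, mul_assoc, Complex.mul_conj, Complex.normSq_eq_norm_sq]
    push_cast
    rfl
  rw [this, integral_complex_ofReal, Complex.ofReal_re]

theorem integrable_normSq (f : L2 Λ) : Integrable (fun x => ‖f x‖ ^ 2) (volume.restrict Λ) :=
  (memLp_two_iff_integrable_sq_norm (Lp.memLp f).1).1 (Lp.memLp f)

theorem norm_sq_eq_integral (f : L2 Λ) : ‖f‖ ^ 2 = ∫ x in Λ, ‖f x‖ ^ 2 := by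
  have h : (inner ℂ f f : ℂ) = ((∫ x in Λ, ‖f x‖ ^ 2 : ℝ) : ℂ) := by
    rw [L2.inner_def, ← integral_complex_ofReal]
    refine integral_congr_ae (ae_of_all _ fun x => ?_)
    simp [inner_self_eq_norm_sq_to_K]
  rw [inner_self_eq_norm_sq_to_K] at h
  refine Complex.ofReal_injective (Eq.trans ?_ h)
  push_cast
  rfl

theorem integrable_potential {W : Config d → ℝ} (hW : MemLp W ⊤ (volume.restrict Λ)) (f : L2 Λ) :
    Integrable (fun x => W x * ‖f x‖ ^ 2) (volume.restrict Λ) := by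
  have := memLp_one_iff_integrable.2 (integrable_normSq f)
  exact memLp_one_iff_integrable.1 (this.mul (p := ⊤) (q := 1) hW)

/-- The quadratic form `½ ‖∇u‖² + ∫ W |u|²` on `H¹₀(Λ)`. -/
noncomputable def energy (Λ : Set (Config d)) (W : Config d → ℝ) (u : SobolevSpace Λ) : ℝ :=
  1 / 2 * ∑ k, ‖sobolevGrad Λ k u‖ ^ 2 + ∫ x in Λ, W x * ‖sobolevVal Λ u x‖ ^ 2

theorem energy_le {W W' : Config d → ℝ} {c : ℝ} (hW : MemLp W ⊤ (volume.restrict Λ))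
    (hW' : MemLp W' ⊤ (volume.restrict Λ)) (h : ∀ᵐ x ∂(volume.restrict Λ), W x ≤ W' x + c)
    (u : SobolevSpace Λ) : energy Λ W u ≤ energy Λ W' u + c * ‖sobolevVal Λ u‖ ^ 2 := by
  have : ∫ x in Λ, W x * ‖sobolevVal Λ u x‖ ^ 2 ≤
      (∫ x in Λ, W' x * ‖sobolevVal Λ u x‖ ^ 2) + c * ‖sobolevVal Λ u‖ ^ 2 := by
    rw [norm_sq_eq_integral, ← integral_const_mul,
      ← integral_add (integrable_potential hW' _) ((integrable_normSq _).const_mul c)]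
    refine integral_mono_ae (integrable_potential hW _)
      ((integrable_potential hW' _).add ((integrable_normSq _).const_mul c)) ?_
    filter_upwards [h] with x hx
    have := mul_le_mul_of_nonneg_right hx (sq_nonneg ‖sobolevVal Λ u x‖)
    rw [add_mul] at this
    exact this
  unfold energy
  linarith

theorem energy_lower {W : Config d → ℝ} {w : ℝ} (hW : MemLp W ⊤ (volume.restrict Λ))
    (h : ∀ᵐ x ∂(volume.restrict Λ), -w ≤ W x) (u : SobolevSpace Λ) :
    1 / 2 * ∑ k, ‖sobolevGrad Λ k u‖ ^ 2 ≤ energy Λ W u + w * ‖sobolevVal Λ u‖ ^ 2 := by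
  have h0 : MemLp (fun _ : Config d => (0 : ℝ)) ⊤ (volume.restrict Λ) := MemLp.zero
  have := energy_le h0 hW (c := w) (by filter_upwards [h] with x hx; linarith) u
  refine le_trans (le_of_eq ?_) this
  simp [energy]

theorem energy_coercive {W : Config d → ℝ} {w : ℝ} (hW : MemLp W ⊤ (volume.restrict Λ))
    (h : ∀ᵐ x ∂(volume.restrict Λ), -w ≤ W x) (u : SobolevSpace Λ) :
    1 / 2 * ‖u‖ ^ 2 ≤ energy Λ W u + (1 / 2 + w) * ‖sobolevVal Λ u‖ ^ 2 := by
  have := energy_lower hW h u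
  rw [sobolev_norm_sq]
  linarith

/-- The bounded operator on `H¹₀(Λ)` that represents the form `energy`. -/
noncomputable def formOp {W : Config d → ℝ} (hW : MemLp W ⊤ (volume.restrict Λ)) :
    SobolevSpace Λ →L[ℂ] SobolevSpace Λ :=
  (1 / 2 : ℂ) • ∑ k, ContinuousLinearMap.adjoint (sobolevGrad Λ k) ∘L sobolevGrad Λ k +
    ContinuousLinearMap.adjoint (sobolevVal Λ) ∘L mulOp hW ∘L sobolevVal Λ

theorem formOp_inner {W : Config d → ℝ} (hW : MemLp W ⊤ (volume.restrict Λ))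
    (u v : SobolevSpace Λ) : inner ℂ v (formOp hW u) =
      (1 / 2 : ℂ) * ∑ k, inner ℂ (sobolevGrad Λ k v) (sobolevGrad Λ k u) +
        inner ℂ (sobolevVal Λ v) (mulOp hW (sobolevVal Λ u)) := by
  simp [formOp, sum_apply, ContinuousLinearMap.adjoint_inner_right]

theorem formOp_isSelfAdjoint {W : Config d → ℝ} (hW : MemLp W ⊤ (volume.restrict Λ)) :
    IsSelfAdjoint (formOp hW) := by
  rw [ContinuousLinearMap.isSelfAdjoint_iff_isSymmetric]
  intro u v
  change inner ℂ (formOp hW u) v = inner ℂ u (formOp hW v)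
  rw [← inner_conj_symm, formOp_inner, formOp_inner, mulOp_inner]
  simp only [map_add, map_mul, map_sum, inner_conj_symm, map_div₀, map_one, map_ofNat]

theorem formOp_inner_re {W : Config d → ℝ} (hW : MemLp W ⊤ (volume.restrict Λ)) :
    (fun u => (inner ℂ u (formOp hW u)).re) = energy Λ W := by
  funext u
  rw [formOp_inner, Complex.add_re, mulOp_inner_re, energy]
  congr 1
  have : ∑ k, inner ℂ (sobolevGrad Λ k u) (sobolevGrad Λ k u)
      = ((∑ k, ‖sobolevGrad Λ k u‖ ^ 2 : ℝ) : ℂ) := by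
    push_cast
    exact Finset.sum_congr rfl fun k _ => inner_self_eq_norm_sq_to_K _
  rw [this]
  rw [show (1 / 2 : ℂ) = ((1 / 2 : ℝ) : ℂ) by push_cast; rfl, ← Complex.ofReal_mul,
    Complex.ofReal_re]

/-! ### The spectrum of the Hamiltonian of a box -/

/-- The set whose infimum is the `k`-th min-max value of `-½Δ + W` on `Λ`. -/
noncomputable def levels (Λ : Set (Config d)) (W : Config d → ℝ) (k : ℕ) : Set ℝ :=
  formLevels (energy Λ W) (sobolevVal Λ) k

/-- With `J = sobolevVal Λ`, the weak equation reads `formOp hW u = J* f`. Questions about the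
unbounded operator thus become questions about bounded operators on `H¹₀`. -/
theorem mem_hamiltonianGraph_iff {W : Config d → ℝ} (hW : MemLp W ⊤ (volume.restrict Λ))
    (p : L2 Λ × L2 Λ) : p ∈ hamiltonianGraph Λ W ↔
      ∃ u, sobolevVal Λ u = p.1 ∧
        formOp hW u = ContinuousLinearMap.adjoint (sobolevVal Λ) p.2 := by
  constructor
  · rintro ⟨g, w, hg, hw, h⟩
    obtain ⟨u, hu, hu'⟩ := exists_sobolev_eq hg
    refine ⟨u, hu, ext_inner_left ℂ fun v => ?_⟩
    rw [formOp_inner, ContinuousLinearMap.adjoint_inner_right, ← h _ (sobolev_mem v)]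
    have e : mulOp hW (sobolevVal Λ u) = w := by
      refine Lp.ext ?_
      filter_upwards [mulOp_coeFn hW (sobolevVal Λ u), hw] with x h1 h2
      rw [h1, h2, hu]
    simp [e, hu']
  · rintro ⟨u, hu, h⟩
    refine ⟨fun k => sobolevGrad Λ k u, mulOp hW (sobolevVal Λ u), ?_, ?_, fun q hq => ?_⟩
    · rw [← hu]
      exact sobolev_mem u
    · rw [← hu]
      exact mulOp_coeFn hW _
    · obtain ⟨v, hv, hv'⟩ := exists_sobolev_eq hq
      have := formOp_inner hW u v
      rw [h, ContinuousLinearMap.adjoint_inner_right, hv] at this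
      rw [this]
      simp [hv']

/-- If `B = A - z J* J` is invertible on `H¹₀`, with `A` the form operator, then `J B⁻¹ J*` is the
resolvent at `z`. -/
theorem mem_resolventSetOf_of_isUnit {u : Config d} {L : Fin 2 → ℝ} {W : Config d → ℝ}
    (hW : MemLp W ⊤ (volume.restrict (box u L))) {z : ℂ}
    (h : IsUnit (formOp hW - z • (ContinuousLinearMap.adjoint (sobolevVal (box u L)) ∘L
      sobolevVal (box u L)))) : z ∈ resolventSetOf (hamiltonian (box u L) W) := by
  set J := sobolevVal (box u L)
  obtain ⟨B, hB⟩ := h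
  have h1 : ∀ y, formOp hW (B⁻¹.1 y) = y + z • ContinuousLinearMap.adjoint J (J (B⁻¹.1 y)) :=
    fun y => by
      have := congrArg (fun T : _ →L[ℂ] _ => T y) (B.mul_inv)
      simp only [hB, mul_apply_eq_comp, sub_apply, smul_apply,
        ContinuousLinearMap.comp_apply, one_apply_eq_self] at this
      exact sub_eq_iff_eq_add.1 this
  have h2 : ∀ v, B⁻¹.1 (formOp hW v - z • ContinuousLinearMap.adjoint J (J v)) = v := fun v => by
    have := congrArg (fun T : _ →L[ℂ] _ => T v) (B.inv_mul)
    simpa only [hB, mul_apply_eq_comp, sub_apply, smul_apply,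
        ContinuousLinearMap.comp_apply, one_apply_eq_self] using this
  refine ⟨J ∘L B⁻¹.1 ∘L ContinuousLinearMap.adjoint J, fun y => ?_, fun x => ?_⟩
  · set v := B⁻¹.1 (ContinuousLinearMap.adjoint J y)
    have hmem : (J v, y + z • J v) ∈ (hamiltonian (box u L) W).graph := by
      rw [graph_hamiltonian_box, mem_hamiltonianGraph_iff hW]
      refine ⟨v, rfl, ?_⟩
      rw [h1, map_add, map_smul]
    obtain ⟨x, hx, hx'⟩ := (LinearPMap.mem_graph_iff _).1 hmem
    refine ⟨x, hx, ?_⟩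
    rw [hx', hx]
    simp
  · have hmem := (hamiltonian (box u L) W).mem_graph x
    rw [graph_hamiltonian_box, mem_hamiltonianGraph_iff hW] at hmem
    obtain ⟨v, hv, hv'⟩ := hmem
    simp only [ContinuousLinearMap.comp_apply, map_sub, map_smul] at hv hv' ⊢
    have := h2 v
    rw [map_sub, map_smul] at this
    have h3 := congrArg J this
    rw [map_sub, map_smul] at h3
    rw [← hv', ← hv]
    simpa only [map_sub, map_smul] using h3

theorem exists_level_eq_of_mem_spectrum {u : Config d} {L : Fin 2 → ℝ} {W : Config d → ℝ}
    {w b t : ℝ} {N : ℕ} (hW : MemLp W ⊤ (volume.restrict (box u L)))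
    (hw : ∀ᵐ x ∂(volume.restrict (box u L)), -w ≤ W x)
    (hN : ∀ k, ∀ t' ∈ levels (box u L) W k, t' ≤ b + 1 → k < N) (htb : t ≤ b)
    (ht : t ∈ realSpectrum (hamiltonian (box u L) W)) :
    ∃ k < N, (levels (box u L) W k).Nonempty ∧ sInf (levels (box u L) W k) = t := by
  have e := formOp_inner_re hW
  have h := exists_level_eq_of_not_isUnit (formOp_isSelfAdjoint hW) (J := sobolevVal (box u L))
    (c := 1 / 2) (m := 1 / 2 + w) (b := b) (t := t) (N := N) (by norm_num)
    (fun v => by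
      have := energy_coercive hW hw v
      rwa [← e] at this)
    (by rw [e]; exact hN) htb (fun hu => ht (mem_resolventSetOf_of_isUnit hW hu))
  rw [e] at h
  exact h

theorem levels_bddBelow {W : Config d → ℝ} {w : ℝ} (hW : MemLp W ⊤ (volume.restrict Λ))
    (hw : ∀ᵐ x ∂(volume.restrict Λ), -w ≤ W x) (k : ℕ) : BddBelow (levels Λ W k) :=
  formLevels_bddBelow one_half_pos (energy_coercive hW hw) k

theorem exists_ae_bound {W : Config d → ℝ} (hW : MemLp W ⊤ (volume.restrict Λ)) :
    ∃ w : ℝ, ∀ᵐ x ∂(volume.restrict Λ), |W x| ≤ w := by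
  refine ⟨(eLpNorm W ⊤ (volume.restrict Λ)).toReal, ?_⟩
  have h := ae_le_eLpNormEssSup (f := W) (μ := volume.restrict Λ)
  filter_upwards [h] with x hx
  rw [← eLpNorm_exponent_top] at hx
  have := ENNReal.toReal_mono hW.2.ne hx
  simpa using this

theorem sInf_levels_le {W W' : Config d → ℝ} {c : ℝ} {k : ℕ} (hW : MemLp W ⊤ (volume.restrict Λ))
    (hW' : MemLp W' ⊤ (volume.restrict Λ)) (h : ∀ᵐ x ∂(volume.restrict Λ), W x ≤ W' x + c)
    (hne : (levels Λ W' k).Nonempty) : sInf (levels Λ W k) ≤ sInf (levels Λ W' k) + c := by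
  obtain ⟨w, hw⟩ := exists_ae_bound hW
  exact sInf_formLevels_le (levels_bddBelow hW (w := w)
    (by filter_upwards [hw] with x hx using neg_le_of_abs_le hx) k) hne (energy_le hW hW' h)

/-- Since nonemptiness does not depend on the bounded potential, it can be assumed for zero
amplitudes, free of randomness. -/
theorem levels_nonempty {W W' : Config d → ℝ} {k : ℕ} (hW : MemLp W ⊤ (volume.restrict Λ))
    (hW' : MemLp W' ⊤ (volume.restrict Λ)) (hne : (levels Λ W' k).Nonempty) :
    (levels Λ W k).Nonempty := by
  obtain ⟨w, hw⟩ := exists_ae_bound (hW.sub hW')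
  obtain ⟨t, ht⟩ := hne
  refine ⟨_, formLevels_shift (energy_le hW hW' (c := w) ?_) ht⟩
  filter_upwards [hw] with x hx
  have := le_of_abs_le hx
  simp only [Pi.sub_apply] at this
  linarith

end Sobolev

/-! ### A Poincaré inequality on convex sets -/

section Poincare

theorem sq_lintegral_le {α : Type*} [MeasurableSpace α] (μ : Measure α) {f : α → ℝ≥0∞}
    (hf : AEMeasurable f μ) : (∫⁻ x, f x ∂μ) ^ 2 ≤ μ univ * ∫⁻ x, f x ^ 2 ∂μ := by
  have h := ENNReal.lintegral_mul_le_Lp_mul_Lq μ Real.HolderConjugate.two_two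
    (aemeasurable_const (b := (1 : ℝ≥0∞))) hf
  simp only [Pi.mul_apply, one_mul, ENNReal.rpow_two, one_pow, lintegral_one] at h
  calc (∫⁻ x, f x ∂μ) ^ 2
      ≤ (μ univ ^ (1 / 2 : ℝ) * (∫⁻ x, f x ^ 2 ∂μ) ^ (1 / 2 : ℝ)) ^ 2 := by gcongr
    _ = μ univ * ∫⁻ x, f x ^ 2 ∂μ := by
        rw [mul_pow, ← ENNReal.rpow_two, ← ENNReal.rpow_two, ← ENNReal.rpow_mul,
          ← ENNReal.rpow_mul]
        norm_num

theorem ennreal_add_sq_le (a b : ℝ≥0∞) : (a + b) ^ 2 ≤ 2 * a ^ 2 + 2 * b ^ 2 := by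
  rcases eq_or_ne a ⊤ with rfl | ha
  · simp
  rcases eq_or_ne b ⊤ with rfl | hb
  · simp
  lift a to ℝ≥0 using ha
  lift b to ℝ≥0 using hb
  norm_cast
  rw [← NNReal.coe_le_coe]
  push_cast
  nlinarith [sq_nonneg ((a : ℝ) - b)]

variable {d : ℕ}

/-- The homothety with centre `x` and ratio `s` maps the convex set `Q` into itself, and its inverse
has Jacobian `s⁻ⁿ`, at most `2ⁿ` for `s ≥ 1 / 2`. -/
theorem lintegral_comp_segment_le {h : Config d → ℝ≥0∞} (hh : Measurable h) {Q : Set (Config d)}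
    (hQ : MeasurableSet Q) (hQc : Convex ℝ Q) {x : Config d} (hx : x ∈ Q) {s : ℝ}
    (hs : 1 / 2 ≤ s) (hs1 : s ≤ 1) :
    ∫⁻ y in Q, h ((1 - s) • x + s • y) ≤
      2 ^ Module.finrank ℝ (Config d) * ∫⁻ y in Q, h y := by
  set n := Module.finrank ℝ (Config d)
  set g := Q.indicator h
  have hg : Measurable g := hh.indicator hQ
  have hs0 : 0 < s := by linarith
  have hg' : Measurable fun z => g ((1 - s) • x + z) := hg.comp (measurable_const_add _)
  calc ∫⁻ y in Q, h ((1 - s) • x + s • y)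
      = ∫⁻ y in Q, g ((1 - s) • x + s • y) := by
        refine setLIntegral_congr_fun hQ fun y hy => ?_
        have : (1 - s) • x + s • y ∈ Q := hQc hx hy (by linarith) hs0.le (by ring)
        exact (indicator_of_mem this h).symm
    _ ≤ ∫⁻ y, g ((1 - s) • x + s • y) := setLIntegral_le_lintegral _ _
    _ = ∫⁻ z, g ((1 - s) • x + z) ∂(Measure.map (fun y => s • y) volume) := by
        rw [lintegral_map hg' (measurable_const_smul s)]
    _ = ENNReal.ofReal |(s ^ n)⁻¹| * ∫⁻ z, g z := by
        rw [Measure.map_addHaar_smul volume hs0.ne', lintegral_smul_measure,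
          lintegral_add_left_eq_self g, smul_eq_mul]
    _ ≤ 2 ^ n * ∫⁻ y in Q, h y := by
        rw [lintegral_indicator hQ]
        gcongr
        rw [abs_of_nonneg (by positivity), ← inv_pow,
          ENNReal.ofReal_pow (by positivity)]
        gcongr
        rw [← ENNReal.ofReal_ofNat 2]
        refine ENNReal.ofReal_le_ofReal ?_
        rw [inv_le_comm₀ hs0 two_pos]
        linarith

/-- Integrate the derivative along the segment from `x` to `y` and apply the Cauchy–Schwarz
inequality. -/
theorem enorm_sub_sq_le_lintegral {φ : Config d → ℂ} (hφ : ContDiff ℝ 1 φ) {ℓ : ℝ}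
    {x y : Config d} (hxy : ‖y - x‖ ≤ ℓ) :
    ‖φ y - φ x‖ₑ ^ 2 ≤ ENNReal.ofReal ℓ ^ 2 *
      ∫⁻ t in Ioc (0 : ℝ) 1, ‖fderiv ℝ φ ((1 - t) • x + t • y)‖ₑ ^ 2 := by
  have hc : Continuous fun t : ℝ => (1 - t) • x + t • y := by fun_prop
  have hD : Continuous fun t : ℝ => fderiv ℝ φ ((1 - t) • x + t • y) :=
    (hφ.continuous_fderiv (by simp)).comp hc
  have hder : ∀ t : ℝ, HasDerivAt (fun t : ℝ => φ ((1 - t) • x + t • y))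
      (fderiv ℝ φ ((1 - t) • x + t • y) (y - x)) t := fun t => by
    have h1 : HasDerivAt (fun t : ℝ => (1 - t) • x + t • y) (y - x) t := by
      have h2 : HasDerivAt (fun t : ℝ => (1 - t) • x + t • y) ((-1 : ℝ) • x + (1 : ℝ) • y) t :=
        (((hasDerivAt_id t).const_sub 1).smul_const x).add ((hasDerivAt_id t).smul_const y)
      refine h2.congr_deriv ?_
      module
    exact ((hφ.differentiable (by simp) _).hasFDerivAt).comp_hasDerivAt t h1
  have hint := intervalIntegral.integral_eq_sub_of_hasDerivAt (a := 0) (b := 1)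
    (fun t _ => hder t) ((hD.clm_apply continuous_const).intervalIntegrable _ _)
  simp only [sub_zero, one_smul, zero_smul, add_zero, sub_self, zero_add] at hint
  rw [intervalIntegral.integral_of_le zero_le_one] at hint
  have hm : AEMeasurable (fun t : ℝ => ‖fderiv ℝ φ ((1 - t) • x + t • y)‖ₑ)
      (volume.restrict (Ioc (0 : ℝ) 1)) := hD.enorm.aemeasurable
  have h1 : ‖φ y - φ x‖ₑ ≤ ENNReal.ofReal ℓ *
      ∫⁻ t in Ioc (0 : ℝ) 1, ‖fderiv ℝ φ ((1 - t) • x + t • y)‖ₑ := by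
    rw [← hint, ← lintegral_const_mul'' _ hm]
    refine (enorm_integral_le_lintegral_enorm _).trans (lintegral_mono fun t => ?_)
    refine (ContinuousLinearMap.le_opENorm _ _).trans ?_
    rw [mul_comm]
    gcongr
    rw [← ofReal_norm]
    exact ENNReal.ofReal_le_ofReal hxy
  calc ‖φ y - φ x‖ₑ ^ 2 ≤ (ENNReal.ofReal ℓ *
      ∫⁻ t in Ioc (0 : ℝ) 1, ‖fderiv ℝ φ ((1 - t) • x + t • y)‖ₑ) ^ 2 := by gcongr
    _ ≤ _ := by
      rw [mul_pow]
      gcongr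
      refine (sq_lintegral_le _ hm).trans ?_
      simp

theorem lintegral_lintegral_enorm_sub_sq_le {φ : Config d → ℂ} (hφ : ContDiff ℝ 1 φ)
    {Q : Set (Config d)} (hQ : MeasurableSet Q) (hQc : Convex ℝ Q) {ℓ : ℝ}
    (hd : ∀ x ∈ Q, ∀ y ∈ Q, ‖y - x‖ ≤ ℓ) :
    ∫⁻ x in Q, ∫⁻ y in Q, ‖φ y - φ x‖ₑ ^ 2 ≤ ENNReal.ofReal ℓ ^ 2 *
      (2 ^ Module.finrank ℝ (Config d) * (volume Q * ∫⁻ x in Q, ‖fderiv ℝ φ x‖ₑ ^ 2)) := by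
  set h : Config d → ℝ≥0∞ := fun x => ‖fderiv ℝ φ x‖ₑ ^ 2 with hh
  set n := Module.finrank ℝ (Config d)
  have hc : Continuous fun x => fderiv ℝ φ x := hφ.continuous_fderiv (by simp)
  have hm : Measurable h := hc.enorm.measurable.pow_const 2
  have hm3 : Measurable fun p : Config d × Config d × ℝ =>
      h ((1 - p.2.2) • p.1 + p.2.2 • p.2.1) :=
    hm.comp (by fun_prop : Continuous fun p : Config d × Config d × ℝ =>
      (1 - p.2.2) • p.1 + p.2.2 • p.2.1).measurable
  have hfix : ∀ t ∈ Ioc (0 : ℝ) 1, ∫⁻ x in Q, ∫⁻ y in Q, h ((1 - t) • x + t • y) ≤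
      2 ^ n * (volume Q * ∫⁻ x in Q, h x) := fun t ht => by
    have e : 2 ^ n * (volume Q * ∫⁻ x in Q, h x) = ∫⁻ _ in Q, 2 ^ n * ∫⁻ x in Q, h x := by
      rw [setLIntegral_const]
      ring
    rw [e]
    -- The homothety must have ratio at least `1 / 2`: for large `t` the point `y` moves and `x` is
    -- fixed, for small `t` the roles are exchanged.
    rcases le_total (1 / 2) t with h1 | h1
    · exact setLIntegral_mono' hQ fun x hx => lintegral_comp_segment_le hm hQ hQc hx h1 ht.2
    · rw [lintegral_lintegral_swap]
      · refine setLIntegral_mono' hQ fun y hy => ?_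
        have := lintegral_comp_segment_le hm hQ hQc hy (s := 1 - t) (by linarith)
          (by linarith [ht.1])
        simpa only [sub_sub_cancel, add_comm] using this
      · exact (hm.comp (by fun_prop : Continuous fun p : Config d × Config d =>
          (1 - t) • p.1 + t • p.2).measurable).aemeasurable
  calc ∫⁻ x in Q, ∫⁻ y in Q, ‖φ y - φ x‖ₑ ^ 2
      ≤ ∫⁻ x in Q, ∫⁻ y in Q, ENNReal.ofReal ℓ ^ 2 *
          ∫⁻ t in Ioc (0 : ℝ) 1, h ((1 - t) • x + t • y) :=
        setLIntegral_mono' hQ fun x hx => setLIntegral_mono' hQ fun y hy =>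
          enorm_sub_sq_le_lintegral hφ (hd x hx y hy)
    _ = ENNReal.ofReal ℓ ^ 2 * ∫⁻ x in Q, ∫⁻ y in Q,
          ∫⁻ t in Ioc (0 : ℝ) 1, h ((1 - t) • x + t • y) := by
        rw [← lintegral_const_mul' _ _ (by finiteness)]
        refine lintegral_congr fun x => ?_
        rw [lintegral_const_mul' _ _ (by finiteness)]
    _ = ENNReal.ofReal ℓ ^ 2 * ∫⁻ t in Ioc (0 : ℝ) 1, ∫⁻ x in Q, ∫⁻ y in Q,
          h ((1 - t) • x + t • y) := by
        congr 1
        refine (lintegral_congr fun x => lintegral_lintegral_swap ?_).trans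
          (lintegral_lintegral_swap ?_)
        · exact (hm3.comp (by fun_prop : Measurable fun p : Config d × ℝ =>
            (x, p.1, p.2))).aemeasurable
        · exact (Measurable.lintegral_prod_right' (ν := volume.restrict Q)
            (hm3.comp (by fun_prop : Measurable fun p : (Config d × ℝ) × Config d =>
              (p.1.1, p.2, p.1.2)))).aemeasurable
    _ ≤ ENNReal.ofReal ℓ ^ 2 * ∫⁻ _ in Ioc (0 : ℝ) 1, 2 ^ n * (volume Q * ∫⁻ x in Q, h x) := by
        exact mul_le_mul' le_rfl (setLIntegral_mono' measurableSet_Ioc hfix)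
    _ = _ := by simp

/-- Write `|Q| φ x = ∫ φ - ∫ (φ y - φ x) dy`, square, and integrate over `x`; the double integral of
differences is controlled by the gradient. -/
theorem lintegral_enorm_sq_le {φ : Config d → ℂ} (hφ : ContDiff ℝ 1 φ)
    {Q : Set (Config d)} (hQ : MeasurableSet Q) (hQc : Convex ℝ Q) {ℓ : ℝ}
    (hd : ∀ x ∈ Q, ∀ y ∈ Q, ‖y - x‖ ≤ ℓ) (hi : IntegrableOn φ Q) (h0 : volume Q ≠ 0)
    (htop : volume Q ≠ ⊤) :
    ∫⁻ x in Q, ‖φ x‖ₑ ^ 2 ≤ 2 * (volume Q)⁻¹ * ‖∫ x in Q, φ x‖ₑ ^ 2 +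
      2 * ENNReal.ofReal ℓ ^ 2 * 2 ^ Module.finrank ℝ (Config d) *
        ∫⁻ x in Q, ‖fderiv ℝ φ x‖ₑ ^ 2 := by
  set m := volume Q
  set n := Module.finrank ℝ (Config d)
  have hcont : Continuous φ := hφ.continuous
  have hpt : ∀ x, m ^ 2 * ‖φ x‖ₑ ^ 2 ≤
      2 * ‖∫ x in Q, φ x‖ₑ ^ 2 + 2 * (m * ∫⁻ y in Q, ‖φ y - φ x‖ₑ ^ 2) := fun x => by
    have hconst : IntegrableOn (fun _ : Config d => φ x) Q := integrableOn_const htop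
    have e : (m.toReal : ℂ) * φ x = (∫ y in Q, φ y) - ∫ y in Q, (φ y - φ x) := by
      rw [integral_sub hi hconst, setIntegral_const]
      simp [Measure.real, m]
    have h1 : m * ‖φ x‖ₑ ≤ ‖∫ y in Q, φ y‖ₑ + ∫⁻ y in Q, ‖φ y - φ x‖ₑ := by
      have h2 : ‖(m.toReal : ℂ) * φ x‖ₑ = m * ‖φ x‖ₑ := by
        rw [enorm_mul, ← ofReal_norm (m.toReal : ℂ), Complex.norm_real,
          Real.norm_of_nonneg ENNReal.toReal_nonneg, ENNReal.ofReal_toReal htop]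
      rw [← h2, e]
      refine enorm_sub_le.trans ?_
      gcongr
      exact enorm_integral_le_lintegral_enorm _
    have hm : AEMeasurable (fun y => ‖φ y - φ x‖ₑ) (volume.restrict Q) :=
      (hcont.sub continuous_const).enorm.aemeasurable
    calc m ^ 2 * ‖φ x‖ₑ ^ 2 = (m * ‖φ x‖ₑ) ^ 2 := by rw [mul_pow]
      _ ≤ (‖∫ y in Q, φ y‖ₑ + ∫⁻ y in Q, ‖φ y - φ x‖ₑ) ^ 2 := by gcongr
      _ ≤ _ := ennreal_add_sq_le _ _
      _ ≤ _ := by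
        gcongr
        refine (sq_lintegral_le _ hm).trans (le_of_eq ?_)
        rw [Measure.restrict_apply_univ]
  have hm2 : Measurable fun x => ∫⁻ y in Q, ‖φ y - φ x‖ₑ ^ 2 := by
    have : Continuous fun p : Config d × Config d => φ p.2 - φ p.1 := by fun_prop
    exact (this.enorm.measurable.pow_const 2).lintegral_prod_right'
  have hfin : 2 * m ≠ ⊤ := by finiteness
  have hint : m ^ 2 * ∫⁻ x in Q, ‖φ x‖ₑ ^ 2 ≤
      m * (2 * ‖∫ x in Q, φ x‖ₑ ^ 2) + 2 * m * ∫⁻ x in Q, ∫⁻ y in Q, ‖φ y - φ x‖ₑ ^ 2 := by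
    rw [← lintegral_const_mul' _ _ (by finiteness)]
    refine (lintegral_mono hpt).trans (le_of_eq ?_)
    rw [lintegral_add_left measurable_const, setLIntegral_const]
    simp only [← mul_assoc]
    rw [lintegral_const_mul' _ _ hfin]
    ring
  have hD := lintegral_lintegral_enorm_sub_sq_le hφ hQ hQc hd
  set G := ∫⁻ x in Q, ‖fderiv ℝ φ x‖ₑ ^ 2
  have hmm : m * m⁻¹ = 1 := ENNReal.mul_inv_cancel h0 htop
  have hle : m ^ 2 * ∫⁻ x in Q, ‖φ x‖ₑ ^ 2 ≤ m ^ 2 * (2 * m⁻¹ * ‖∫ x in Q, φ x‖ₑ ^ 2 +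
      2 * ENNReal.ofReal ℓ ^ 2 * 2 ^ n * G) := by
    refine hint.trans ?_
    calc _ ≤ m * (2 * ‖∫ x in Q, φ x‖ₑ ^ 2) +
          2 * m * (ENNReal.ofReal ℓ ^ 2 * (2 ^ n * (m * G))) := by gcongr
      _ = (m * m⁻¹) * m * (2 * ‖∫ x in Q, φ x‖ₑ ^ 2) +
          2 * m * (ENNReal.ofReal ℓ ^ 2 * (2 ^ n * (m * G))) := by rw [hmm, one_mul]
      _ = _ := by ring
  exact (ENNReal.mul_le_mul_iff_right (pow_ne_zero 2 h0) (by finiteness)).1 hle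

end Poincare

/-! ### Counting levels with a grid -/

section Counting

variable {d : ℕ} {Λ : Set (Config d)}

/-- The half-open cell of side `ℓ` of the grid `ℓ ℤ^{2d}` with corner `ℓ z`. -/
def cell (ℓ : ℝ) (z : Fin 2 → Fin d → ℤ) : Set (Config d) :=
  univ.pi fun j => univ.pi fun i => Ico (ℓ * z j i) (ℓ * (z j i + 1))

theorem mem_cell {ℓ : ℝ} {z : Fin 2 → Fin d → ℤ} {x : Config d} :
    x ∈ cell ℓ z ↔ ∀ j i, ℓ * z j i ≤ x j i ∧ x j i < ℓ * (z j i + 1) := by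
  simp [cell]

theorem mem_cell_iff_floor {ℓ : ℝ} (hℓ : 0 < ℓ) {z : Fin 2 → Fin d → ℤ} {x : Config d} :
    x ∈ cell ℓ z ↔ ∀ j i, ⌊x j i / ℓ⌋ = z j i := by
  simp only [mem_cell, Int.floor_eq_iff, le_div_iff₀ hℓ, div_lt_iff₀ hℓ, mul_comm ℓ]

theorem measurableSet_cell (ℓ : ℝ) (z : Fin 2 → Fin d → ℤ) : MeasurableSet (cell ℓ z) :=
  MeasurableSet.univ_pi fun _ => MeasurableSet.univ_pi fun _ => measurableSet_Ico

theorem convex_cell (ℓ : ℝ) (z : Fin 2 → Fin d → ℤ) : Convex ℝ (cell ℓ z) :=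
  convex_pi fun _ _ => convex_pi fun _ _ => convex_Ico _ _

theorem volume_cell {ℓ : ℝ} (hℓ : 0 < ℓ) (z : Fin 2 → Fin d → ℤ) :
    volume (cell ℓ z) = ENNReal.ofReal (ℓ ^ (2 * d)) := by
  have h : ∀ j i, ℓ * ((z j i : ℝ) + 1) - ℓ * z j i = ℓ := fun j i => by ring
  rw [cell, volume_pi_pi]
  simp only [volume_pi_pi, Real.volume_Ico, h, Finset.prod_const, Finset.card_univ,
    Fintype.card_fin]
  rw [← pow_mul, mul_comm d 2, ENNReal.ofReal_pow hℓ.le]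

theorem norm_sub_le_of_mem_cell {ℓ : ℝ} (hℓ : 0 < ℓ) {z : Fin 2 → Fin d → ℤ} {x y : Config d}
    (hx : x ∈ cell ℓ z) (hy : y ∈ cell ℓ z) : ‖y - x‖ ≤ ℓ := by
  rw [mem_cell] at hx hy
  refine (pi_norm_le_iff_of_nonneg hℓ.le).2 fun j => (pi_norm_le_iff_of_nonneg hℓ.le).2 fun i => ?_
  obtain ⟨h1, h2⟩ := hx j i
  obtain ⟨h3, h4⟩ := hy j i
  rw [Pi.sub_apply, Pi.sub_apply, Real.norm_eq_abs, abs_le]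
  constructor <;> linarith

theorem pairwiseDisjoint_cell {ℓ : ℝ} (hℓ : 0 < ℓ) (Z : Set (Fin 2 → Fin d → ℤ)) :
    Z.PairwiseDisjoint (cell ℓ) := by
  intro z _ z' _ hne
  refine Set.disjoint_left.2 fun x hx hx' => hne ?_
  rw [mem_cell_iff_floor hℓ] at hx hx'
  funext j i
  rw [← hx, ← hx']

/-- The corners of the grid cells that meet a box. -/
noncomputable def boxCells (ℓ : ℝ) (u : Config d) (L : Fin 2 → ℝ) :
    Finset (Fin 2 → Fin d → ℤ) :=
  Finset.Icc (fun j i => ⌊(u j i - L j) / ℓ⌋) (fun j i => ⌊(u j i + L j) / ℓ⌋)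

theorem box_subset_cells {ℓ : ℝ} (hℓ : 0 < ℓ) (u : Config d) (L : Fin 2 → ℝ) :
    box u L ⊆ ⋃ z ∈ boxCells ℓ u L, cell ℓ z := by
  intro x hx
  refine mem_iUnion₂.2 ⟨fun j i => ⌊x j i / ℓ⌋, ?_, (mem_cell_iff_floor hℓ).2 fun _ _ => rfl⟩
  refine Finset.mem_Icc.2 ⟨fun j i => ?_, fun j i => ?_⟩
  · exact Int.floor_le_floor (by gcongr; exact (hx j i).1)
  · exact Int.floor_le_floor (by gcongr; exact (hx j i).2)

theorem cube_eq_pi (v : Fin d → ℝ) (L : ℝ) :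
    cube v L = univ.pi fun i => Icc (v i - L) (v i + L) := by
  ext y
  simp only [cube, mem_ofPred_eq, mem_univ_pi, mem_Icc]

theorem box_eq_pi (u : Config d) (L : Fin 2 → ℝ) :
    box u L = univ.pi fun j => cube (u j) (L j) := by
  ext x
  simp [box]

theorem measurableSet_cube (v : Fin d → ℝ) (L : ℝ) : MeasurableSet (cube v L) := by
  rw [cube_eq_pi]
  exact MeasurableSet.univ_pi fun _ => measurableSet_Icc

theorem measurableSet_box (u : Config d) (L : Fin 2 → ℝ) : MeasurableSet (box u L) := by
  rw [box_eq_pi]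
  exact MeasurableSet.univ_pi fun _ => measurableSet_cube _ _

theorem volume_cube (v : Fin d → ℝ) (L : ℝ) :
    volume (cube v L) = ENNReal.ofReal (2 * L) ^ d := by
  have h : ∀ i, v i + L - (v i - L) = 2 * L := fun i => by ring
  rw [cube_eq_pi, volume_pi_pi]
  simp [Real.volume_Icc, h]

theorem volume_box (u : Config d) (L : Fin 2 → ℝ) :
    volume (box u L) = ∏ j, ENNReal.ofReal (2 * L j) ^ d := by
  rw [box_eq_pi, volume_pi_pi]
  simp [volume_cube]

theorem card_boxCells_le {ℓ : ℝ} (hℓ : 0 < ℓ) (u : Config d) {L : Fin 2 → ℝ} (hL : ∀ j, 1 < L j) :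
    ((boxCells ℓ u L).card : ℝ≥0∞) ≤
      ENNReal.ofReal ((1 / ℓ + 1) ^ (2 * d)) * volume (box u L) := by
  have h : ∀ j i, ((Finset.Icc ⌊(u j i - L j) / ℓ⌋ ⌊(u j i + L j) / ℓ⌋).card : ℝ≥0∞) ≤
      ENNReal.ofReal (1 / ℓ + 1) * ENNReal.ofReal (2 * L j) := fun j i => by
    rw [← ENNReal.ofReal_mul (by positivity), ← ENNReal.ofReal_natCast, Int.card_Icc]
    refine ENNReal.ofReal_le_ofReal ?_
    have hle : ⌊(u j i - L j) / ℓ⌋ ≤ ⌊(u j i + L j) / ℓ⌋ :=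
      Int.floor_le_floor (by gcongr; linarith [hL j])
    have e : (((⌊(u j i + L j) / ℓ⌋ + 1 - ⌊(u j i - L j) / ℓ⌋).toNat : ℤ) : ℝ) =
        ((⌊(u j i + L j) / ℓ⌋ + 1 - ⌊(u j i - L j) / ℓ⌋ : ℤ) : ℝ) := by
      rw [Int.toNat_of_nonneg (by omega)]
    rw [← Int.cast_natCast, e]
    push_cast
    -- Each coordinate contributes at most `2 L / ℓ + 2` indices, and `2 ≤ 2 L` because `L > 1`.
    have h1 := Int.floor_le ((u j i + L j) / ℓ)
    have h2 := Int.lt_floor_add_one ((u j i - L j) / ℓ)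
    have h3 : (u j i + L j) / ℓ - (u j i - L j) / ℓ = 1 / ℓ * (2 * L j) := by ring
    linarith [hL j]
  rw [boxCells, Pi.card_Icc]
  simp only [Pi.card_Icc, Nat.cast_prod]
  calc _ ≤ ∏ j : Fin 2, ∏ _i : Fin d, (ENNReal.ofReal (1 / ℓ + 1) * ENNReal.ofReal (2 * L j)) :=
        Finset.prod_le_prod' fun j _ => Finset.prod_le_prod' fun i _ => h j i
    _ = _ := by
      simp only [Finset.prod_const, Finset.card_univ, Fintype.card_fin, mul_pow,
        Finset.prod_mul_distrib, volume_box]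
      rw [← pow_mul, mul_comm d 2, ENNReal.ofReal_pow (by positivity)]

/-- For the maximum norm on configurations, the operator norm is at most the sum of the moduli of
the `2 d` partial derivatives; Cauchy–Schwarz gives the factor `2 d`. -/
theorem enorm_fderiv_sq_le (φ : Config d → ℂ) (x : Config d) :
    ‖fderiv ℝ φ x‖ₑ ^ 2 ≤ (2 * d : ℕ) * ∑ k, ‖fderiv ℝ φ x (unitVec k)‖ₑ ^ 2 := by
  have hv : ∀ v : Config d, v = ∑ k : Fin 2 × Fin d, v k.1 k.2 • unitVec k := fun v => by
    funext j i
    rw [Fintype.sum_prod_type]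
    simp only [Finset.sum_apply, Pi.smul_apply, unitVec, smul_eq_mul]
    rw [Finset.sum_eq_single j, Finset.sum_eq_single i]
    · simp
    · intro i' _ hi
      simp [hi.symm]
    · simp
    · intro j' _ hj
      simp [hj.symm]
    · simp
  have h1 : ‖fderiv ℝ φ x‖ ≤ ∑ k, ‖fderiv ℝ φ x (unitVec k)‖ := by
    refine ContinuousLinearMap.opNorm_le_bound _ (by positivity) fun v => ?_
    conv_lhs => rw [hv v]
    rw [map_sum, Finset.sum_mul]
    refine (norm_sum_le _ _).trans (Finset.sum_le_sum fun k _ => ?_)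
    rw [map_smul, norm_smul, mul_comm]
    gcongr
    exact (norm_le_pi_norm (v k.1) k.2).trans (norm_le_pi_norm v k.1)
  have h2 : ‖fderiv ℝ φ x‖ ^ 2 ≤ (2 * d : ℕ) * ∑ k, ‖fderiv ℝ φ x (unitVec k)‖ ^ 2 := by
    refine (pow_le_pow_left₀ (norm_nonneg _) h1 2).trans (sq_sum_le_card_mul_sum_sq.trans ?_)
    simp
  have h3 := ENNReal.ofReal_le_ofReal h2
  rw [ENNReal.ofReal_mul (by positivity), ENNReal.ofReal_sum_of_nonneg (fun _ _ => by positivity),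
    ENNReal.ofReal_natCast, ENNReal.ofReal_pow (norm_nonneg _), ofReal_norm] at h3
  simpa only [ENNReal.ofReal_pow (norm_nonneg _), ofReal_norm] using h3

theorem ofReal_norm_sq (f : L2 Λ) : ENNReal.ofReal (‖f‖ ^ 2) = ∫⁻ x in Λ, ‖f x‖ₑ ^ 2 := by
  rw [norm_sq_eq_integral, ofReal_integral_eq_lintegral_ofReal (integrable_normSq f)
    (ae_of_all _ fun _ => by positivity)]
  refine lintegral_congr fun x => ?_
  rw [ENNReal.ofReal_pow (norm_nonneg _), ofReal_norm]

/-- The integral over a cell, as a functional on `L²(Λ)`. -/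
noncomputable def cellFunctional (Λ : Set (Config d)) {ℓ : ℝ} (hℓ : 0 < ℓ)
    (z : Fin 2 → Fin d → ℤ) : L2 Λ →L[ℂ] ℂ :=
  innerSL ℂ (indicatorConstLp 2 (μ := volume.restrict Λ) (measurableSet_cell ℓ z)
    (((Measure.restrict_apply_le _ _).trans_lt (by
      rw [volume_cell hℓ]
      exact ENNReal.ofReal_lt_top)).ne) (1 : ℂ))

theorem cellFunctional_apply {ℓ : ℝ} (hℓ : 0 < ℓ) (z : Fin 2 → Fin d → ℤ) (f : L2 Λ) :
    cellFunctional Λ hℓ z f = ∫ x in cell ℓ z, f x ∂(volume.restrict Λ) := by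
  rw [cellFunctional, innerSL_apply_apply, L2.inner_indicatorConstLp_one]

/-- A test function vanishes outside `Λ`, so cells that stick out can be used whole. The cell means
are kept on the right so that the inequality passes to the closure `H¹₀`: approximating test
functions need not have zero means. -/
theorem norm_sq_le_of_mem_testGraph (hΛ : MeasurableSet Λ) {ℓ : ℝ} (hℓ : 0 < ℓ)
    {Z : Finset (Fin 2 → Fin d → ℤ)} (hZ : Λ ⊆ ⋃ z ∈ Z, cell ℓ z)
    {p : L2 Λ × (Fin 2 × Fin d → L2 Λ)} (hp : p ∈ testGraph Λ) :
    ‖p.1‖ ^ 2 ≤ ∑ z ∈ Z, 2 * (ℓ ^ (2 * d))⁻¹ * ‖cellFunctional Λ hℓ z p.1‖ ^ 2 +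
      2 * ℓ ^ 2 * 2 ^ Module.finrank ℝ (Config d) * (2 * d : ℕ) * ∑ k, ‖p.2 k‖ ^ 2 := by
  obtain ⟨φ, hφ, hp1, hp2⟩ := hp
  set n := Module.finrank ℝ (Config d)
  have hφ1 : ContDiff ℝ 1 φ := hφ.smooth.of_le (by simp)
  have hint : Integrable φ := hφ.smooth.continuous.integrable_of_hasCompactSupport hφ.compact
  have hφ0 : ∀ x, x ∉ Λ → φ x = 0 := fun x hx =>
    image_eq_zero_of_notMem_tsupport fun h => hx (interior_subset (hφ.supp h))
  have hD0 : ∀ x, x ∉ Λ → fderiv ℝ φ x = 0 := fun x hx =>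
    image_eq_zero_of_notMem_tsupport fun h => hx (interior_subset (hφ.supp
      (tsupport_fderiv_subset ℝ h)))
  have e1 : ENNReal.ofReal (‖p.1‖ ^ 2) = ∫⁻ x in Λ, ‖φ x‖ₑ ^ 2 := by
    rw [ofReal_norm_sq]
    refine lintegral_congr_ae ?_
    filter_upwards [hp1] with x hx
    rw [hx]
  have e2 : ∀ k, ENNReal.ofReal (‖p.2 k‖ ^ 2) = ∫⁻ x in Λ, ‖fderiv ℝ φ x (unitVec k)‖ₑ ^ 2 :=
    fun k => by
      rw [ofReal_norm_sq]
      refine lintegral_congr_ae ?_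
      filter_upwards [hp2 k] with x hx
      rw [hx]
  have e3 : ∀ z, ∫ x in cell ℓ z, φ x = cellFunctional Λ hℓ z p.1 := fun z => by
    have h1 : ∫ x in cell ℓ z, φ x = ∫ x in cell ℓ z ∩ Λ, φ x := by
      refine setIntegral_eq_of_subset_of_forall_sdiff_eq_zero (measurableSet_cell ℓ z)
        inter_subset_left fun x hx => hφ0 x fun h => hx.2 ⟨hx.1, h⟩
    rw [h1, cellFunctional_apply, Measure.restrict_restrict (measurableSet_cell ℓ z)]
    refine (integral_congr_ae ?_).symm
    exact ae_restrict_of_ae_restrict_of_subset inter_subset_right hp1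
  have hgrad : ∑ z ∈ Z, ∫⁻ x in cell ℓ z, ‖fderiv ℝ φ x‖ₑ ^ 2 ≤
      (2 * d : ℕ) * ∑ k, ENNReal.ofReal (‖p.2 k‖ ^ 2) := by
    calc ∑ z ∈ Z, ∫⁻ x in cell ℓ z, ‖fderiv ℝ φ x‖ₑ ^ 2
        = ∫⁻ x in ⋃ z ∈ Z, cell ℓ z, ‖fderiv ℝ φ x‖ₑ ^ 2 :=
          (lintegral_biUnion_finset (pairwiseDisjoint_cell hℓ _)
            (fun z _ => measurableSet_cell ℓ z) _).symm
      _ ≤ ∫⁻ x, ‖fderiv ℝ φ x‖ₑ ^ 2 := setLIntegral_le_lintegral _ _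
      _ = ∫⁻ x in Λ, ‖fderiv ℝ φ x‖ₑ ^ 2 := by
          rw [← lintegral_indicator hΛ]
          refine lintegral_congr fun x => ?_
          by_cases hx : x ∈ Λ
          · rw [indicator_of_mem hx]
          · rw [indicator_of_notMem hx, hD0 x hx]
            have : ‖(0 : Config d →L[ℝ] ℂ)‖ₑ = 0 := by
              rw [← ofReal_norm, norm_zero, ENNReal.ofReal_zero]
            rw [this]
            simp
      _ ≤ ∫⁻ x in Λ, (2 * d : ℕ) * ∑ k, ‖fderiv ℝ φ x (unitVec k)‖ₑ ^ 2 :=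
          lintegral_mono fun x => enorm_fderiv_sq_le φ x
      _ = _ := by
          rw [lintegral_const_mul' _ _ (by finiteness), lintegral_finsetSum]
          · simp only [e2]
          · intro k _
            exact (((hφ1.continuous_fderiv (by simp)).clm_apply
              continuous_const).enorm.measurable.pow_const 2)
  have key : ENNReal.ofReal (‖p.1‖ ^ 2) ≤
      ∑ z ∈ Z, 2 * (ENNReal.ofReal (ℓ ^ (2 * d)))⁻¹ * ‖cellFunctional Λ hℓ z p.1‖ₑ ^ 2 +
      2 * ENNReal.ofReal ℓ ^ 2 * 2 ^ n * ((2 * d : ℕ) * ∑ k, ENNReal.ofReal (‖p.2 k‖ ^ 2)) := by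
    calc ENNReal.ofReal (‖p.1‖ ^ 2)
        ≤ ∫⁻ x in ⋃ z ∈ Z, cell ℓ z, ‖φ x‖ₑ ^ 2 := by
          rw [e1]
          exact lintegral_mono_set hZ
      _ = ∑ z ∈ Z, ∫⁻ x in cell ℓ z, ‖φ x‖ₑ ^ 2 :=
          lintegral_biUnion_finset (pairwiseDisjoint_cell hℓ _)
            (fun z _ => measurableSet_cell ℓ z) _
      _ ≤ ∑ z ∈ Z, (2 * (ENNReal.ofReal (ℓ ^ (2 * d)))⁻¹ * ‖cellFunctional Λ hℓ z p.1‖ₑ ^ 2 +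
            2 * ENNReal.ofReal ℓ ^ 2 * 2 ^ n * ∫⁻ x in cell ℓ z, ‖fderiv ℝ φ x‖ₑ ^ 2) := by
          refine Finset.sum_le_sum fun z _ => ?_
          rw [← e3, ← volume_cell hℓ z]
          refine lintegral_enorm_sq_le hφ1 (measurableSet_cell ℓ z) (convex_cell ℓ z)
            (fun x hx y hy => norm_sub_le_of_mem_cell hℓ hx hy) hint.integrableOn ?_ ?_
          · rw [volume_cell hℓ]
            simp only [ne_eq, ENNReal.ofReal_eq_zero, not_le]
            positivity
          · rw [volume_cell hℓ]
            exact ENNReal.ofReal_ne_top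
      _ ≤ _ := by
          rw [Finset.sum_add_distrib]
          refine add_le_add le_rfl ?_
          rw [← Finset.mul_sum]
          gcongr
  have hpos : 0 < ℓ ^ (2 * d) := by positivity
  rw [← ENNReal.ofReal_le_ofReal_iff (by positivity)]
  refine key.trans (le_of_eq ?_)
  rw [ENNReal.ofReal_add (by positivity) (by positivity),
    ENNReal.ofReal_sum_of_nonneg (fun _ _ => by positivity), ← ENNReal.ofReal_inv_of_pos hpos,
    ← ENNReal.ofReal_sum_of_nonneg (fun _ _ => by positivity)]
  congr 1
  · refine Finset.sum_congr rfl fun z _ => ?_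
    rw [ENNReal.ofReal_mul (by positivity), ENNReal.ofReal_mul (by positivity),
      ENNReal.ofReal_pow (norm_nonneg _), ofReal_norm, ENNReal.ofReal_ofNat]
  · rw [ENNReal.ofReal_mul (by positivity), ENNReal.ofReal_mul (by positivity),
      ENNReal.ofReal_mul (by positivity), ENNReal.ofReal_mul (by positivity),
      ENNReal.ofReal_pow hℓ.le, ENNReal.ofReal_pow zero_le_two, ENNReal.ofReal_ofNat,
      ENNReal.ofReal_natCast]
    ring

theorem norm_sq_le_of_cellFunctional_eq_zero (hΛ : MeasurableSet Λ) {ℓ : ℝ} (hℓ : 0 < ℓ)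
    {Z : Finset (Fin 2 → Fin d → ℤ)} (hZ : Λ ⊆ ⋃ z ∈ Z, cell ℓ z) (u : SobolevSpace Λ)
    (hu : ∀ z ∈ Z, cellFunctional Λ hℓ z (sobolevVal Λ u) = 0) :
    ‖sobolevVal Λ u‖ ^ 2 ≤ 2 * ℓ ^ 2 * 2 ^ Module.finrank ℝ (Config d) * (2 * d : ℕ) *
      ∑ k, ‖sobolevGrad Λ k u‖ ^ 2 := by
  have hcl : IsClosed {p : L2 Λ × (Fin 2 × Fin d → L2 Λ) |
      ‖p.1‖ ^ 2 ≤ ∑ z ∈ Z, 2 * (ℓ ^ (2 * d))⁻¹ * ‖cellFunctional Λ hℓ z p.1‖ ^ 2 +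
      2 * ℓ ^ 2 * 2 ^ Module.finrank ℝ (Config d) * (2 * d : ℕ) * ∑ k, ‖p.2 k‖ ^ 2} :=
    isClosed_le (by fun_prop) (by fun_prop)
  have h := closure_minimal (fun p hp => norm_sq_le_of_mem_testGraph hΛ hℓ hZ hp) hcl
    (sobolev_mem u : _ ∈ closure (testGraph Λ : Set (L2 Λ × (Fin 2 × Fin d → L2 Λ))))
  refine le_trans h (le_of_eq ?_)
  rw [Finset.sum_eq_zero, zero_add]
  intro z hz
  simp [hu z hz]

/-- On a subspace of low energy, a function whose cell means all vanish is zero by the Poincaré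
inequality. The means therefore embed a space of dimension `k + 1` into `Z → ℂ`. -/
theorem lt_card_of_mem_levels (hΛ : MeasurableSet Λ) {ℓ : ℝ} (hℓ : 0 < ℓ)
    {Z : Finset (Fin 2 → Fin d → ℤ)} (hZ : Λ ⊆ ⋃ z ∈ Z, cell ℓ z) {W : Config d → ℝ} {w E t : ℝ}
    (hW : MemLp W ⊤ (volume.restrict Λ)) (hw : ∀ᵐ x ∂(volume.restrict Λ), -w ≤ W x) {k : ℕ}
    (ht : t ∈ levels Λ W k) (htE : t + w ≤ E)
    (hE : 2 * ℓ ^ 2 * 2 ^ Module.finrank ℝ (Config d) * (2 * d : ℕ) * (2 * E) < 1) :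
    k < Z.card := by
  obtain ⟨F, hF, h⟩ := ht
  have : FiniteDimensional ℂ F := Module.finite_of_finrank_pos (by omega)
  let T : F →ₗ[ℂ] (Z → ℂ) := LinearMap.pi fun z =>
    (cellFunctional Λ hℓ z ∘L sobolevVal Λ).toLinearMap ∘ₗ F.subtype
  have hT : Function.Injective T := by
    rw [← LinearMap.ker_eq_bot, LinearMap.ker_eq_bot']
    rintro ⟨u, hu⟩ h0
    have h1 := norm_sq_le_of_cellFunctional_eq_zero hΛ hℓ hZ u
      fun z hz => congrFun h0 ⟨z, hz⟩
    have h2 := energy_lower hW hw u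
    have h3 := energy_coercive hW hw u
    have h4 := h u hu
    set c := 2 * ℓ ^ 2 * 2 ^ Module.finrank ℝ (Config d) * ((2 * d : ℕ) : ℝ)
    have hc : 0 ≤ c := by positivity
    set s := ‖sobolevVal Λ u‖ ^ 2
    have hs : 0 ≤ s := by positivity
    have h5 : ∑ k, ‖sobolevGrad Λ k u‖ ^ 2 ≤ 2 * E * s := by nlinarith
    have h6 : s ≤ c * (2 * E) * s := by
      have := mul_le_mul_of_nonneg_left h5 hc
      linarith
    have h7 : s = 0 := by nlinarith
    have h8 : ‖u‖ ^ 2 ≤ 0 := by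
      rw [h7] at h3 h4
      linarith
    have h9 : u = 0 := by
      rw [← norm_eq_zero]
      exact pow_eq_zero_iff two_ne_zero |>.1 (le_antisymm h8 (sq_nonneg _))
    exact Subtype.ext h9
  have := LinearMap.finrank_le_finrank_of_injective hT
  simp only [hF, Module.finrank_fintype_fun_eq_card, Fintype.card_coe] at this
  omega

/-- A Weyl type bound: the number of min-max values below a fixed energy is at most a multiple of
the volume of the box. -/
theorem exists_level_count (d : ℕ) (w b : ℝ) : ∃ C : ℝ, 0 < C ∧
    ∀ (u : Config d) (L : Fin 2 → ℝ), (∀ j, 1 < L j) → ∃ N : ℕ,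
      (N : ℝ≥0∞) ≤ ENNReal.ofReal C * volume (box u L) ∧
      ∀ W : Config d → ℝ, MemLp W ⊤ (volume.restrict (box u L)) →
        (∀ᵐ x ∂(volume.restrict (box u L)), -w ≤ W x) →
        ∀ k, ∀ t ∈ levels (box u L) W k, t ≤ b → k < N := by
  set E := |b| + |w|
  set K := 2 * 2 ^ Module.finrank ℝ (Config d) * ((2 * d : ℕ) : ℝ) * (2 * E) with hKd
  have hK : 0 ≤ K := by positivity
  -- The cells must be so fine that `K * ℓ ^ 2 < 1`; here this is `K / (1 + K) ^ 2 < 1`.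
  set ℓ := 1 / (1 + K)
  have hℓ : 0 < ℓ := by positivity
  refine ⟨(1 / ℓ + 1) ^ (2 * d), by positivity, fun u L hL =>
    ⟨(boxCells ℓ u L).card, card_boxCells_le hℓ u hL, fun W hW hw k t ht htb => ?_⟩⟩
  refine lt_card_of_mem_levels (measurableSet_box u L) hℓ (box_subset_cells hℓ u L) hW hw ht
    (E := E) (add_le_add (htb.trans (le_abs_self b)) (le_abs_self w)) ?_
  have e : 2 * ℓ ^ 2 * 2 ^ Module.finrank ℝ (Config d) * ((2 * d : ℕ) : ℝ) * (2 * E) =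
      K / (1 + K) ^ 2 := by
    simp only [ℓ, hKd, one_div, inv_pow]
    ring
  rw [e, div_lt_one (by positivity)]
  nlinarith

end Counting

/-! ### A conditional version of Stollmann's lemma -/

section Stollmann

theorem measurable_update_offSite {d : ℕ} {Ω : Type*} {V : (Fin d → ℤ) → Ω → ℝ}
    {s : Fin d → ℤ} (y : ℝ) :
    Measurable[offSite V s] fun ω => Function.update (fun t => V t ω) s y := by
  refine @measurable_pi_lambda _ _ _ (offSite V s) _ _ fun t => ?_
  by_cases h : t = s
  · subst h
    simp only [Function.update_self]
    exact measurable_const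
  · simp only [Function.update_of_ne h]
    exact Measurable.mono (comap_measurable (V t))
      (le_iSup (fun t : {t // t ≠ s} => MeasurableSpace.comap (V t) inferInstance) ⟨t, h⟩) le_rfl

variable {d : ℕ} {Ω : Type*} [mΩ : MeasurableSpace Ω] {P : Measure Ω} [IsProbabilityMeasure P]
  {V : (Fin d → ℤ) → Ω → ℝ}

theorem offSite_le (hV : ∀ s, Measurable (V s)) (s : Fin d → ℤ) : offSite V s ≤ mΩ :=
  iSup_le fun t => (hV t).comap_le

/-- As `G` depends only on the other amplitudes, the probability is the integral over `G` of the
increment of the conditional distribution function. -/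
theorem measure_inter_Ico_le (hV : ∀ s, Measurable (V s)) {s : Fin d → ℤ} {G : Set Ω}
    (hG : MeasurableSet[offSite V s] G) {η : ℝ} (hη : 0 < η) (y : ℝ) :
    P (G ∩ V s ⁻¹' Ico y (y + η)) ≤ P G * condModulus P V η := by
  have hm := offSite_le hV s
  have hG' : MeasurableSet G := hm _ hG
  have hI : ∀ z, MeasurableSet (V s ⁻¹' Iio z) := fun z => hV s measurableSet_Iio
  have hint : ∀ z, Integrable ((V s ⁻¹' Iio z).indicator fun _ => (1 : ℝ)) P := fun z =>
    (integrable_const 1).indicator (hI z)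
  have hnn : ∀ᵐ ω ∂P, 0 ≤ condCdf P V s (y + η) ω - condCdf P V s y ω := by
    have : condCdf P V s y ≤ᵐ[P] condCdf P V s (y + η) := by
      refine condExp_mono (hint _) (hint _) (ae_of_all _ fun ω => ?_)
      exact indicator_le_indicator_of_subset (preimage_mono (Iio_subset_Iio (by linarith)))
        (fun _ => zero_le_one) ω
    filter_upwards [this] with ω h using sub_nonneg.2 h
  have hle : ∀ᵐ ω ∂P, ENNReal.ofReal (condCdf P V s (y + η) ω - condCdf P V s y ω) ≤
      condModulus P V η := by
    filter_upwards [ae_le_essSup (f := fun ω => ENNReal.ofReal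
      (condCdf P V s (y + η) ω - condCdf P V s y ω)) (μ := P)] with ω h
    exact h.trans (le_iSup₂ (f := fun (s : Fin d → ℤ) (y : ℝ) => essSup (fun ω => ENNReal.ofReal
      (condCdf P V s (y + η) ω - condCdf P V s y ω)) P) s y)
  have hci : ∀ z, Integrable (condCdf P V s z) P := fun z => integrable_condExp
  have hset : ∀ z, ∫ ω in G, condCdf P V s z ω ∂P = P.real (G ∩ V s ⁻¹' Iio z) := fun z => by
    rw [condCdf, setIntegral_condExp hm (hint z) hG, setIntegral_indicator (hI z)]
    simp
  have hdiff : P.real (G ∩ V s ⁻¹' Ico y (y + η)) =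
      ∫ ω in G, (condCdf P V s (y + η) ω - condCdf P V s y ω) ∂P := by
    rw [integral_sub (hci _).integrableOn (hci _).integrableOn, hset, hset,
      ← measureReal_sdiff]
    · congr 1
      ext ω
      simp only [mem_inter_iff, mem_preimage, mem_Ico, Set.mem_sdiff, mem_Iio, not_and, not_lt]
      tauto
    · exact inter_subset_inter_right _ (preimage_mono (Iio_subset_Iio (by linarith)))
    · exact hG'.inter (hI y)
  rw [← ENNReal.ofReal_toReal (measure_ne_top P (G ∩ V s ⁻¹' Ico y (y + η)))]
  change ENNReal.ofReal (P.real _) ≤ _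
  have hcd : IntegrableOn (fun ω => condCdf P V s (y + η) ω - condCdf P V s y ω) G P :=
    ((hci _).sub (hci _)).integrableOn
  rw [hdiff, ofReal_integral_eq_lintegral_ofReal hcd (ae_restrict_of_ae hnn), mul_comm,
    ← setLIntegral_const]
  exact lintegral_mono_ae (ae_restrict_of_ae hle)

/-- With the other amplitudes fixed, `T` is a down-closed set of values at `s`, and the event says
that `V s` exceeds its threshold by at most `η`. The threshold is random but depends on the other
amplitudes only, so it is localised on the grid `η ℤ` before conditioning. -/
theorem measure_shift_one_le (hV : ∀ s, Measurable (V s)) {T : Set ((Fin d → ℤ) → ℝ)}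
    (hT : MeasurableSet T) {s : Fin d → ℤ}
    (hdown : ∀ v ∈ T, ∀ y ≤ v s, Function.update v s y ∈ T) {η : ℝ} (hη : 0 < η) :
    P {ω | Function.update (fun t => V t ω) s (V s ω - η) ∈ T ∧ (fun t => V t ω) ∉ T} ≤
      2 * condModulus P V η := by
  let v : Ω → (Fin d → ℤ) → ℝ := fun ω t => V t ω
  have hd : ∀ ω y z, z ≤ y → Function.update (v ω) s y ∈ T → Function.update (v ω) s z ∈ T :=
    fun ω y z hzy h => by simpa using hdown _ h z (by simpa using hzy)
  -- On `G i` the threshold lies between `i * η` and `(i + 1) * η`, so `V s` is confined to two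
  -- adjacent intervals of length `η`; hence the factor `2`. The `G i` are disjoint, so their
  -- probabilities add up to at most `1`.
  let G : ℤ → Set Ω := fun i => {ω | Function.update (v ω) s (i * η) ∈ T ∧
    Function.update (v ω) s ((i + 1) * η) ∉ T}
  have hG : ∀ i, MeasurableSet[offSite V s] (G i) := fun i =>
    MeasurableSet.inter (measurable_update_offSite (V := V) (i * η) hT)
      (MeasurableSet.compl (measurable_update_offSite (V := V) ((i + 1) * η) hT))
  have hG' : ∀ i, MeasurableSet (G i) := fun i => offSite_le hV s _ (hG i)
  have hdisj : Pairwise (Function.onFun Disjoint G) := by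
    have : ∀ i j : ℤ, i < j → Disjoint (G i) (G j) := fun i j hij =>
      Set.disjoint_left.2 fun ω hi hj => hi.2 (hd ω _ _ (by
        have : (i : ℝ) + 1 ≤ j := by exact_mod_cast hij
        gcongr) hj.1)
    intro i j hij
    rcases lt_or_gt_of_ne hij with h | h
    · exact this i j h
    · exact (this j i h).symm
  have hsub : {ω | Function.update (fun t => V t ω) s (V s ω - η) ∈ T ∧ (fun t => V t ω) ∉ T} ⊆
      ⋃ i : ℤ, (G i ∩ V s ⁻¹' Ico (i * η) (i * η + η)) ∪
        (G i ∩ V s ⁻¹' Ico (i * η + η) (i * η + η + η)) := by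
    rintro ω ⟨h1, h2⟩
    have h2' : Function.update (v ω) s (V s ω) ∉ T := by
      have : Function.update (v ω) s (V s ω) = v ω := Function.update_eq_self s (v ω)
      rwa [this]
    -- The threshold is not below `V s ω - η`, so its grid index is `a` or `a + 1`, according to
    -- whether the value `(a + 1) * η` is still in `T`.
    set a := ⌊(V s ω - η) / η⌋ with ha
    have ha1 : a * η ≤ V s ω - η := by
      rw [← le_div_iff₀ hη]
      exact Int.floor_le _
    have ha2 : V s ω - η < (a + 1) * η := by
      rw [← div_lt_iff₀ hη]
      exact Int.lt_floor_add_one _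
    have hmem : ∀ i : ℤ, ω ∈ G i → i * η ≤ V s ω → V s ω < i * η + η + η →
        ω ∈ ⋃ i : ℤ, (G i ∩ V s ⁻¹' Ico (i * η) (i * η + η)) ∪
        (G i ∩ V s ⁻¹' Ico (i * η + η) (i * η + η + η)) := fun i hi h3 h4 => by
      refine mem_iUnion.2 ⟨i, ?_⟩
      rcases lt_or_ge (V s ω) (i * η + η) with h5 | h5
      · exact Or.inl ⟨hi, h3, h5⟩
      · exact Or.inr ⟨hi, h5, h4⟩
    by_cases h3 : Function.update (v ω) s ((a + 1) * η) ∈ T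
    · refine hmem (a + 1) ⟨by push_cast; exact h3, fun h => h2' (hd ω _ _ ?_ h)⟩ ?_ ?_
      · push_cast
        linarith
      · push_cast
        by_contra! h4
        exact h2' (hd ω _ _ h4.le h3)
      · push_cast
        linarith
    · exact hmem a ⟨hd ω _ _ ha1 h1, h3⟩ (by linarith) (by linarith)
  calc _ ≤ P (⋃ i : ℤ, (G i ∩ V s ⁻¹' Ico (i * η) (i * η + η)) ∪
        (G i ∩ V s ⁻¹' Ico (i * η + η) (i * η + η + η))) := measure_mono hsub
    _ ≤ ∑' i : ℤ, P ((G i ∩ V s ⁻¹' Ico (i * η) (i * η + η)) ∪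
        (G i ∩ V s ⁻¹' Ico (i * η + η) (i * η + η + η))) := measure_iUnion_le _
    _ ≤ ∑' i : ℤ, P (G i) * (2 * condModulus P V η) := by
        refine ENNReal.tsum_le_tsum fun i => (measure_union_le _ _).trans ?_
        rw [two_mul, mul_add]
        exact add_le_add (measure_inter_Ico_le hV (hG i) hη _)
          (measure_inter_Ico_le hV (hG i) hη _)
    _ = P (⋃ i, G i) * (2 * condModulus P V η) := by
        rw [ENNReal.tsum_mul_right, measure_iUnion hdisj hG']
    _ ≤ 1 * (2 * condModulus P V η) := by
        gcongr
        exact prob_le_one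
    _ = 2 * condModulus P V η := one_mul _

/-- The amplitudes `v`, lowered by `η` at the sites of `S`. -/
noncomputable def lower (S : Finset (Fin d → ℤ)) (η : ℝ) (v : (Fin d → ℤ) → ℝ) :
    (Fin d → ℤ) → ℝ := fun t => v t - η * (S : Set (Fin d → ℤ)).indicator 1 t

theorem lower_insert {S : Finset (Fin d → ℤ)} {s : Fin d → ℤ} (hs : s ∉ S) (η : ℝ)
    (v : (Fin d → ℤ) → ℝ) :
    lower (insert s S) η v = Function.update (lower S η v) s (lower S η v s - η) := by
  classical
  funext t
  by_cases h : t = s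
  · subst h
    simp [lower, hs]
  · simp [lower, h, indicator_apply]

/-- Lower the sites one after the other. Each step costs one application of `measure_shift_one_le`;
the preimage of `T` under the shift at `s` is again closed downwards at the remaining sites. -/
theorem measure_lower_le (hV : ∀ s, Measurable (V s)) {η : ℝ} (hη : 0 < η)
    (S : Finset (Fin d → ℤ)) {T : Set ((Fin d → ℤ) → ℝ)} (hT : MeasurableSet T)
    (hdown : ∀ s ∈ S, ∀ v ∈ T, ∀ y ≤ v s, Function.update v s y ∈ T) :
    P {ω | lower S η (fun t => V t ω) ∈ T ∧ (fun t => V t ω) ∉ T} ≤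
      S.card * (2 * condModulus P V η) := by
  classical
  induction S using Finset.induction_on generalizing T with
  | empty =>
    have h0 : ∀ v : (Fin d → ℤ) → ℝ, lower ∅ η v = v := fun v => by
      funext t
      simp [lower]
    have : {ω | lower ∅ η (fun t => V t ω) ∈ T ∧ (fun t => V t ω) ∉ T} = ∅ := by
      ext ω
      simp [h0]
    rw [this]
    simp
  | insert s S hs ih =>
    let f : ((Fin d → ℤ) → ℝ) → (Fin d → ℤ) → ℝ := fun v => Function.update v s (v s - η)
    have hf : Measurable f := by
      refine measurable_pi_lambda _ fun t => ?_
      by_cases h : t = s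
      · subst h
        simp only [f, Function.update_self]
        fun_prop
      · simp only [f, Function.update_of_ne h]
        fun_prop
    have h1 := ih (T := f ⁻¹' T) (hf hT) fun t ht v hv y hy => by
      have hts : t ≠ s := fun h => hs (h ▸ ht)
      have := hdown t (Finset.mem_insert_of_mem ht) (f v) hv y (by simpa [f, hts] using hy)
      change Function.update (Function.update v t y) s (Function.update v t y s - η) ∈ T
      rw [Function.update_of_ne hts.symm, Function.update_comm hts]
      exact this
    have h2 := measure_shift_one_le (P := P) hV hT (hdown s (Finset.mem_insert_self s S)) hη
    refine (measure_mono (t := {ω | lower S η (fun t => V t ω) ∈ f ⁻¹' T ∧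
      (fun t => V t ω) ∉ f ⁻¹' T} ∪ {ω | Function.update (fun t => V t ω) s (V s ω - η) ∈ T ∧
        (fun t => V t ω) ∉ T}) ?_).trans ((measure_union_le _ _).trans ?_)
    · rintro ω ⟨h3, h4⟩
      by_cases h5 : Function.update (fun t => V t ω) s (V s ω - η) ∈ T
      · exact Or.inr ⟨h5, h4⟩
      · refine Or.inl ⟨?_, h5⟩
        rw [lower_insert hs] at h3
        exact h3
    · rw [Finset.card_insert_of_notMem hs, Nat.cast_add, Nat.cast_one, add_mul, one_mul]
      exact add_le_add h1 h2

/-- A random variable that is a monotone function of the amplitudes on `S`, and decreases by at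
least `η` if these are lowered by `η`, falls into an interval of length `η` with probability at most
`2 |S| ν(η)`. -/
theorem measure_Ioc_le (hV : ∀ s, Measurable (V s)) {η : ℝ} (hη : 0 < η)
    (S : Finset (Fin d → ℤ)) {Φ : ((Fin d → ℤ) → ℝ) → ℝ} (hΦ : Measurable Φ)
    (hmono : ∀ s ∈ S, ∀ v, ∀ y ≤ v s, Φ (Function.update v s y) ≤ Φ v)
    (hshift : ∀ v, Φ (lower S η v) ≤ Φ v - η) (c : ℝ) :
    P {ω | Φ (fun t => V t ω) ∈ Ioc c (c + η)} ≤ S.card * (2 * condModulus P V η) := by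
  -- For `T = {Φ ≤ c}`, a value of `Φ` in `(c, c + η]` means that the amplitudes are outside `T` and
  -- enter it when lowered.
  refine (measure_mono ?_).trans (measure_lower_le hV hη S (T := Φ ⁻¹' Iic c)
    (hΦ measurableSet_Iic) fun s hs v hv y hy => (hmono s hs v y hy).trans hv)
  rintro ω ⟨h1, h2⟩
  exact ⟨(hshift _).trans (by linarith), fun h => absurd h1 (not_lt.2 h)⟩

end Stollmann

/-! ### Dependence of the potential on the amplitudes -/

section Alloy

variable {d : ℕ}

/-- The lattice points of a cube. -/
noncomputable def sites (v : Fin d → ℝ) (r : ℝ) : Finset (Fin d → ℤ) :=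
  Finset.Icc (fun i => ⌈v i - r⌉) (fun i => ⌊v i + r⌋)

theorem mem_sites {v : Fin d → ℝ} {r : ℝ} {s : Fin d → ℤ} :
    s ∈ sites v r ↔ latticePt s ∈ cube v r := by
  simp only [sites, Finset.mem_Icc, Pi.le_def, Int.ceil_le, Int.le_floor, cube, latticePt,
    mem_ofPred_eq, forall_and]

theorem card_sites_le (v : Fin d → ℝ) {L : ℝ} (hL : 1 < L) :
    ((sites v L).card : ℝ≥0∞) ≤ 2 ^ d * volume (cube v L) := by
  have h : ∀ i, ((Finset.Icc ⌈v i - L⌉ ⌊v i + L⌋).card : ℝ≥0∞) ≤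
      2 * ENNReal.ofReal (2 * L) := fun i => by
    rw [← ENNReal.ofReal_ofNat 2, ← ENNReal.ofReal_mul (by positivity), ← ENNReal.ofReal_natCast,
      Int.card_Icc]
    refine ENNReal.ofReal_le_ofReal ?_
    have h1 := Int.floor_le (v i + L)
    have h2 := Int.le_ceil (v i - L)
    -- A coordinate takes at most `2 L + 1` integer values, and `2 L + 1 ≤ 4 L`.
    rcases le_total 0 (⌊v i + L⌋ + 1 - ⌈v i - L⌉) with h0 | h0
    · have e : (((⌊v i + L⌋ + 1 - ⌈v i - L⌉).toNat : ℤ) : ℝ) =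
          ((⌊v i + L⌋ + 1 - ⌈v i - L⌉ : ℤ) : ℝ) := by
        rw [Int.toNat_of_nonneg h0]
      rw [← Int.cast_natCast, e]
      push_cast
      linarith
    · rw [Int.toNat_of_nonpos h0]
      push_cast
      linarith
  rw [sites, Pi.card_Icc, Nat.cast_prod, volume_cube, ← mul_pow]
  refine (Finset.prod_le_prod' fun i _ => h i).trans ?_
  simp

theorem proj_box (u : Config d) {L : Fin 2 → ℝ} (hL : ∀ j, 1 < L j) (j : Fin 2) :
    proj j (box u L) = cube (u j) (L j) := by
  refine Subset.antisymm ?_ fun y hy => ?_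
  · rintro _ ⟨x, hx, rfl⟩
    exact hx j
  · refine ⟨Function.update u j y, fun j' => ?_, by simp⟩
    by_cases h : j' = j
    · subst h
      simpa using hy
    · rw [Function.update_of_ne h]
      exact fun i => ⟨by linarith [hL j'], by linarith [hL j']⟩

variable {φ : (Fin d → ℤ) → (Fin d → ℝ) → ℝ} {R : ℝ}

theorem bump_eq_zero (hφ : FiniteRange φ R) {v y : Fin d → ℝ} {L : ℝ} (hy : y ∈ cube v L)
    {s : Fin d → ℤ} (hs : s ∉ sites v (L + R)) : φ s (y - latticePt s) = 0 := by
  refine hφ s _ ?_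
  by_contra! h
  refine hs (mem_sites.2 fun i => ?_)
  have h1 := (norm_le_pi_norm (y - latticePt s) i).trans h
  rw [Real.norm_eq_abs, abs_le, Pi.sub_apply] at h1
  have h2 := hy i
  constructor <;> linarith [h1.1, h1.2, h2.1, h2.2]

theorem alloy_eq_sum (hφ : FiniteRange φ R) {v y : Fin d → ℝ} {L : ℝ} (hy : y ∈ cube v L)
    (a : (Fin d → ℤ) → ℝ) :
    alloy φ a y = ∑ s ∈ sites v (L + R), a s * φ s (y - latticePt s) :=
  tsum_eq_sum fun s hs => by rw [bump_eq_zero hφ hy hs, mul_zero]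

theorem exists_bump_sum_le (hφ : BoundedBumps φ) : ∃ K : ℝ, 0 ≤ K ∧
    ∀ (F : Finset (Fin d → ℤ)) (x : Fin d → ℝ), ∑ s ∈ F, φ s (x - latticePt s) ≤ K := by
  obtain ⟨h, K, hK⟩ := hφ
  refine ⟨K, K.2, fun F x => ?_⟩
  have h1 := (ENNReal.sum_le_tsum F).trans (hK x)
  rw [← ENNReal.ofReal_sum_of_nonneg fun s _ => (h s).2.1 _] at h1
  rw [← ENNReal.ofReal_coe_nnreal] at h1
  exact (ENNReal.ofReal_le_ofReal_iff K.2).1 h1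

theorem abs_alloy_sub_le (hφ : BoundedBumps φ) (hR : FiniteRange φ R) {K : ℝ}
    (hK : ∀ (F : Finset (Fin d → ℤ)) (x : Fin d → ℝ), ∑ s ∈ F, φ s (x - latticePt s) ≤ K)
    {v y : Fin d → ℝ} {L δ : ℝ} (hδ : 0 ≤ δ) (hy : y ∈ cube v L) {a b : (Fin d → ℤ) → ℝ}
    (hab : ∀ s ∈ sites v (L + R), |a s - b s| ≤ δ) : |alloy φ a y - alloy φ b y| ≤ δ * K := by
  rw [alloy_eq_sum hR hy, alloy_eq_sum hR hy, ← Finset.sum_sub_distrib]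
  refine (Finset.abs_sum_le_sum_abs _ _).trans ?_
  refine le_trans (Finset.sum_le_sum fun s hs => ?_)
    ((Finset.mul_sum _ _ _).symm.le.trans (mul_le_mul_of_nonneg_left (hK (sites v (L + R)) y) hδ))
  rw [← sub_mul, abs_mul, abs_of_nonneg ((hφ.1 s).2.1 _)]
  exact mul_le_mul_of_nonneg_right (hab s hs) ((hφ.1 s).2.1 _)

theorem alloy_mono (hφ : BoundedBumps φ) (hR : FiniteRange φ R) {a b : (Fin d → ℤ) → ℝ}
    (hab : a ≤ b) (y : Fin d → ℝ) : alloy φ a y ≤ alloy φ b y := by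
  have hy : y ∈ cube y 0 := fun i => by simp
  rw [alloy_eq_sum hR hy, alloy_eq_sum hR hy]
  exact Finset.sum_le_sum fun s _ => mul_le_mul_of_nonneg_right (hab s) ((hφ.1 s).2.1 _)

/-- The change is `η` times the sum of the bumps at the sites of the cube, which is at least `1` on
the whole cube by the covering condition. -/
theorem alloy_lower_le (hR : FiniteRange φ R) (hc : Covering φ) (hR0 : 0 < R)
    {v y : Fin d → ℝ} {L : ℝ} (hL : 1 ≤ L) (hy : y ∈ cube v L) {η : ℝ} (hη : 0 ≤ η)
    (a : (Fin d → ℤ) → ℝ) : alloy φ (lower (sites v L) η a) y ≤ alloy φ a y - η := by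
  classical
  have hsub : sites v L ⊆ sites v (L + R) := fun s hs => by
    rw [mem_sites] at hs ⊢
    exact fun i => ⟨by linarith [(hs i).1], by linarith [(hs i).2]⟩
  have h1 : 1 ≤ ∑ s ∈ sites v L, φ s (y - latticePt s) := by
    refine (hc L hL v y hy).trans (le_of_eq ?_)
    have e := tsum_subtype {s : Fin d → ℤ | latticePt s ∈ cube v L}
      fun s => φ s (y - latticePt s)
    refine Eq.trans e ((tsum_eq_sum (s := sites v L) fun s hs => ?_).trans
      (Finset.sum_congr rfl fun s hs => ?_))
    · exact indicator_of_notMem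
        (show s ∉ {s | latticePt s ∈ cube v L} from fun h => hs (mem_sites.2 h)) _
    · exact indicator_of_mem (show s ∈ {s | latticePt s ∈ cube v L} from mem_sites.1 hs) _
  have h2 : ∑ s ∈ sites v (L + R), ((sites v L : Set (Fin d → ℤ)).indicator 1 s : ℝ) *
      φ s (y - latticePt s) = ∑ s ∈ sites v L, φ s (y - latticePt s) := by
    rw [← Finset.sum_subset hsub]
    · exact Finset.sum_congr rfl fun s hs => by simp [hs]
    · intro s _ hs
      simp [hs]
  rw [alloy_eq_sum hR hy, alloy_eq_sum hR hy]
  simp only [lower, sub_mul, Finset.sum_sub_distrib, mul_assoc]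
  rw [← Finset.mul_sum, h2]
  have := mul_le_mul_of_nonneg_left h1 hη
  linarith

/-! ### Levels of a box as functions of the amplitudes -/

/-- The potential energy `U(x) + V(x₁) + V(x₂)`. -/
noncomputable def potential (U : Config d → ℝ) (φ : (Fin d → ℤ) → (Fin d → ℝ) → ℝ)
    (a : (Fin d → ℤ) → ℝ) (x : Config d) : ℝ := U x + ∑ j, alloy φ a (x j)

variable {U : Config d → ℝ}

theorem potential_memLp (hU : MemLp U ⊤ volume) (hφ : BoundedBumps φ) (hR : FiniteRange φ R)
    (u : Config d) (L : Fin 2 → ℝ) (a : (Fin d → ℤ) → ℝ) :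
    MemLp (potential U φ a) ⊤ (volume.restrict (box u L)) := by
  refine (hU.restrict _).add (memLp_finsetSum _ fun j _ => ?_)
  have h : MemLp (fun x : Config d => ∑ s ∈ sites (u j) (L j + R),
      a s * φ s (x j - latticePt s)) ⊤ (volume.restrict (box u L)) := by
    refine memLp_finsetSum _ fun s _ => MemLp.const_mul ?_ _
    obtain ⟨hm, h0, B, hB⟩ := hφ.1 s
    refine memLp_top_of_bound ?_ B (ae_of_all _ fun x => ?_)
    · exact (hm.comp ((measurable_pi_apply j).sub_const _)).aestronglyMeasurable
    · rw [Real.norm_of_nonneg (h0 _)]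
      exact hB _
  refine h.ae_eq ?_
  filter_upwards [ae_restrict_mem (measurableSet_box u L)] with x hx
  exact (alloy_eq_sum hR (hx j) a).symm

/-- The `k`-th min-max value of the Hamiltonian of a box, as a function of the amplitudes. -/
noncomputable def level (U : Config d → ℝ) (φ : (Fin d → ℤ) → (Fin d → ℝ) → ℝ) (u : Config d)
    (L : Fin 2 → ℝ) (k : ℕ) (a : (Fin d → ℤ) → ℝ) : ℝ :=
  sInf (levels (box u L) (potential U φ a) k)

variable {u : Config d} {L : Fin 2 → ℝ} {k : ℕ}

theorem level_le_add (hU : MemLp U ⊤ volume) (hφ : BoundedBumps φ) (hR : FiniteRange φ R)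
    {a b : (Fin d → ℤ) → ℝ} {c : ℝ} (hne : (levels (box u L) (potential U φ 0) k).Nonempty)
    (h : ∀ x ∈ box u L, ∑ j, alloy φ a (x j) ≤ ∑ j, alloy φ b (x j) + c) :
    level U φ u L k a ≤ level U φ u L k b + c := by
  refine sInf_levels_le (potential_memLp hU hφ hR u L a) (potential_memLp hU hφ hR u L b) ?_
    (levels_nonempty (potential_memLp hU hφ hR u L b) (potential_memLp hU hφ hR u L 0) hne)
  filter_upwards [ae_restrict_mem (measurableSet_box u L)] with x hx
  have := h x hx
  simp only [potential]
  linarith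

theorem level_le_add_of_abs_le (hU : MemLp U ⊤ volume) (hφ : BoundedBumps φ)
    (hR : FiniteRange φ R) {K : ℝ}
    (hK : ∀ (F : Finset (Fin d → ℤ)) (x : Fin d → ℝ), ∑ s ∈ F, φ s (x - latticePt s) ≤ K)
    {a b : (Fin d → ℤ) → ℝ} {δ : ℝ} (hδ : 0 ≤ δ)
    (hne : (levels (box u L) (potential U φ 0) k).Nonempty)
    (h : ∀ j, ∀ s ∈ sites (u j) (L j + R), |a s - b s| ≤ δ) :
    level U φ u L k a ≤ level U φ u L k b + 2 * (δ * K) := by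
  refine level_le_add hU hφ hR hne fun x hx => ?_
  have h1 : ∀ j, alloy φ a (x j) ≤ alloy φ b (x j) + δ * K := fun j => by
    have := le_of_abs_le (abs_alloy_sub_le hφ hR hK hδ (hx j) (h j))
    linarith
  have h2 := h1 0
  have h3 := h1 1
  simp only [Fin.sum_univ_two]
  linarith

theorem level_congr (hU : MemLp U ⊤ volume) (hφ : BoundedBumps φ) (hR : FiniteRange φ R)
    {a b : (Fin d → ℤ) → ℝ} (hne : (levels (box u L) (potential U φ 0) k).Nonempty)
    (h : ∀ j, ∀ s ∈ sites (u j) (L j + R), a s = b s) :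
    level U φ u L k a = level U φ u L k b := by
  obtain ⟨K, -, hK⟩ := exists_bump_sum_le hφ
  refine le_antisymm ?_ ?_
  · simpa using level_le_add_of_abs_le hU hφ hR hK le_rfl hne
      fun j s hs => (by rw [h j s hs, sub_self, abs_zero])
  · simpa using level_le_add_of_abs_le hU hφ hR hK le_rfl hne
      fun j s hs => (by rw [h j s hs, sub_self, abs_zero])

theorem level_mono (hU : MemLp U ⊤ volume) (hφ : BoundedBumps φ) (hR : FiniteRange φ R)
    {a b : (Fin d → ℤ) → ℝ} (hne : (levels (box u L) (potential U φ 0) k).Nonempty)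
    (hab : a ≤ b) : level U φ u L k a ≤ level U φ u L k b := by
  have := level_le_add hU hφ hR hne (a := a) (b := b) (c := 0) fun x _ => by
    rw [add_zero]
    exact Finset.sum_le_sum fun j _ => alloy_mono hφ hR hab _
  linarith

/-- Only the cube of particle `j` is lowered. Its potential drops by at least `η` throughout the
box, and that of the other particle does not rise because the bumps are non-negative. -/
theorem level_lower_le (hU : MemLp U ⊤ volume) (hφ : BoundedBumps φ) (hR : FiniteRange φ R)
    (hc : Covering φ) (hR0 : 0 < R) (hne : (levels (box u L) (potential U φ 0) k).Nonempty)
    {j : Fin 2} (hL : 1 < L j) {η : ℝ} (hη : 0 ≤ η) (a : (Fin d → ℤ) → ℝ) :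
    level U φ u L k (lower (sites (u j) (L j)) η a) ≤ level U φ u L k a - η := by
  rw [sub_eq_add_neg]
  refine level_le_add hU hφ hR hne fun x hx => ?_
  set a' := lower (sites (u j) (L j)) η a
  have ha : a' ≤ a := fun s => by
    simp only [a', lower]
    have : (0 : ℝ) ≤ (sites (u j) (L j) : Set (Fin d → ℤ)).indicator 1 s :=
      indicator_nonneg (fun _ _ => zero_le_one) s
    nlinarith
  have h1 : alloy φ a' (x j) ≤ alloy φ a (x j) - η :=
    alloy_lower_le hR hc hR0 hL.le (hx j) hη a
  rw [← Finset.add_sum_erase _ _ (Finset.mem_univ j),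
    ← Finset.add_sum_erase (a := j) (f := fun j => alloy φ a (x j)) _ (Finset.mem_univ j)]
  have h2 : ∑ i ∈ Finset.univ.erase j, alloy φ a' (x i) ≤
      ∑ i ∈ Finset.univ.erase j, alloy φ a (x i) :=
    Finset.sum_le_sum fun i _ => alloy_mono hφ hR ha _
  linarith

/-- This supplies measurability. Only finitely many amplitudes matter, and the level is Lipschitz in
them, so it is continuous for the product topology. -/
theorem continuous_level (hU : MemLp U ⊤ volume) (hφ : BoundedBumps φ) (hR : FiniteRange φ R)
    (hne : (levels (box u L) (potential U φ 0) k).Nonempty) :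
    Continuous (level U φ u L k) := by
  obtain ⟨K, hK0, hK⟩ := exists_bump_sum_le hφ
  rw [continuous_iff_continuousAt]
  intro a
  let δ : ((Fin d → ℤ) → ℝ) → ℝ := fun b => ∑ j, ∑ s ∈ sites (u j) (L j + R), |b s - a s|
  have hδ0 : ∀ b, 0 ≤ δ b := fun b =>
    Finset.sum_nonneg fun j _ => Finset.sum_nonneg fun s _ => abs_nonneg _
  have hle : ∀ b j, ∀ s ∈ sites (u j) (L j + R), |b s - a s| ≤ δ b := fun b j s hs =>
    (Finset.single_le_sum (f := fun s => |b s - a s|) (fun s _ => abs_nonneg _) hs).trans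
      (Finset.single_le_sum (f := fun j => ∑ s ∈ sites (u j) (L j + R), |b s - a s|)
        (fun j _ => Finset.sum_nonneg fun s _ => abs_nonneg _) (Finset.mem_univ j))
  have hδ : Continuous δ := by fun_prop
  have hlim : Tendsto (fun b => 2 * (δ b * K)) (𝓝 a) (𝓝 0) := by
    have : Continuous fun b => 2 * (δ b * K) := by fun_prop
    have h0 := this.tendsto a
    simpa [δ] using h0
  rw [ContinuousAt, tendsto_iff_dist_tendsto_zero]
  refine squeeze_zero (fun _ => dist_nonneg) (fun b => ?_) hlim
  rw [Real.dist_eq, abs_le]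
  have h1 := level_le_add_of_abs_le hU hφ hR hK (hδ0 b) hne (hle b)
  have h2 := level_le_add_of_abs_le hU hφ hR hK (hδ0 b) hne
    (fun j s hs => by rw [abs_sub_comm]; exact hle b j s hs)
  constructor <;> linarith

/-- The bound is uniform in the box and in the amplitudes, which makes the level count
deterministic. -/
theorem exists_potential_lower_bound (hU : MemLp U ⊤ volume) (hφ : BoundedBumps φ)
    (hR : FiniteRange φ R) (M : ℝ) : ∃ w : ℝ, ∀ (u : Config d) (L : Fin 2 → ℝ)
      (a : (Fin d → ℤ) → ℝ), (∀ s, |a s| ≤ M) →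
        ∀ᵐ x ∂(volume.restrict (box u L)), -w ≤ potential U φ a x := by
  obtain ⟨K, hK0, hK⟩ := exists_bump_sum_le hφ
  obtain ⟨w, hw⟩ := exists_ae_bound (Λ := univ) (hU.restrict univ)
  rw [Measure.restrict_univ] at hw
  refine ⟨w + 2 * (M * K), fun u L a ha => ?_⟩
  have hM : 0 ≤ M := (abs_nonneg _).trans (ha 0)
  filter_upwards [ae_restrict_of_ae hw, ae_restrict_mem (measurableSet_box u L)] with x hx hxb
  have h0 : ∀ y : Fin d → ℝ, alloy φ 0 y = 0 := fun y => by simp [alloy]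
  have h1 : ∀ j, -(M * K) ≤ alloy φ a (x j) := fun j => by
    have := abs_alloy_sub_le hφ hR hK hM (hxb j) (a := a) (b := 0)
      (fun s _ => by simpa using ha s)
    rw [h0, sub_zero] at this
    exact neg_le_of_abs_le this
  have h2 := h1 0
  have h3 := h1 1
  have h4 := neg_le_of_abs_le hx
  simp only [potential, Fin.sum_univ_two]
  linarith

end Alloy

/-! ### The two-volume estimate -/

section TwoVolume

variable {d : ℕ}

theorem setDist_comm (A B : Set ℝ) : setDist A B = setDist B A := by
  unfold setDist
  rw [iInf₂_comm]
  simp only [edist_comm]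

/-- The infimum is not known to be attained; passing to `2 * ε` provides actual points and accounts
for `ν(2ε)`. -/
theorem exists_abs_sub_lt_of_setDist_le {A B : Set ℝ} {ε : ℝ} (hε : 0 < ε)
    (h : setDist A B ≤ ENNReal.ofReal ε) : ∃ x ∈ A, ∃ y ∈ B, |x - y| < 2 * ε := by
  have h1 : setDist A B < ENNReal.ofReal (2 * ε) :=
    h.trans_lt ((ENNReal.ofReal_lt_ofReal_iff (by positivity)).2 (by linarith))
  simp only [setDist, iInf_lt_iff] at h1
  obtain ⟨x, hx, y, hy, hxy⟩ := h1
  refine ⟨x, hx, y, hy, ?_⟩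
  rw [edist_dist, ENNReal.ofReal_lt_ofReal_iff (by positivity), Real.dist_eq] at hxy
  exact hxy

/-- If two boxes are sufficiently distant, a projection of one of them is far from both projections
of the other one. -/
theorem SufficientlyDistant.exists_far {R : ℝ} (hR : 0 < R) {u u' : Config d} {L L' : Fin 2 → ℝ}
    (h : SufficientlyDistant R u L u' L') :
    (∃ j, ∀ j', L j + (L' j' + R) < ‖u j - u' j'‖) ∨
      ∃ j', ∀ j, L' j' + (L j + R) < ‖u' j' - u j‖ := by
  obtain ⟨hL, hL', h⟩ := h
  set r := max (max (L 0 + R) (L 1 + R)) (max (L' 0 + R) (L' 1 + R))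
  have h1 : ∀ j, L j + R ≤ r := fun j => by
    fin_cases j
    · exact (le_max_left _ _).trans (le_max_left _ _)
    · exact (le_max_right _ _).trans (le_max_left _ _)
  have h2 : ∀ j, L' j + R ≤ r := fun j => by
    fin_cases j
    · exact (le_max_left _ _).trans (le_max_right _ _)
    · exact (le_max_right _ _).trans (le_max_right _ _)
  have hr : 0 < r := by linarith [h1 0, hL 0]
  obtain ⟨h3, h4⟩ := lt_min_iff.1 h
  have h5 : ¬ ((∀ j, ‖u j - u' j‖ ≤ 2 * r)) := fun hj => by
    have : ‖u - u'‖ ≤ 2 * r := (pi_norm_le_iff_of_nonneg (by positivity)).2 hj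
    linarith
  have h6 : ¬ (‖u 1 - u' 0‖ ≤ 2 * r ∧ ‖u 0 - u' 1‖ ≤ 2 * r) := fun hj => by
    have : ‖reflect u - u'‖ ≤ 2 * r := (pi_norm_le_iff_of_nonneg (by positivity)).2 fun j => by
      fin_cases j
      · exact hj.1
      · exact hj.2
    linarith
  rw [Fin.forall_fin_two] at h5
  have hs : ∀ j j', ‖u' j' - u j‖ = ‖u j - u' j'‖ := fun j j' => norm_sub_rev _ _
  -- Call a pair of projections close if its distance is at most `2 * r`. By `h5` and `h6` neither
  -- matching of the two pairs of projections is close, so each contains a far pair; two such pairs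
  -- share a projection, which is far from both projections of the other box.
  have key : (∃ j, ∀ j', 2 * r < ‖u j - u' j'‖) ∨ ∃ j', ∀ j, 2 * r < ‖u j - u' j'‖ := by
    simp only [Fin.exists_fin_two, Fin.forall_fin_two, ← not_le]
    tauto
  rcases key with ⟨j, hj⟩ | ⟨j', hj'⟩
  · exact Or.inl ⟨j, fun j' => by linarith [hj j', h1 j, h2 j']⟩
  · exact Or.inr ⟨j', fun j => by rw [hs]; linarith [hj' j, h1 j, h2 j']⟩

theorem notMem_sites_of_far {v v' : Fin d → ℝ} {r r' : ℝ} (hr : 0 ≤ r + r')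
    (h : r + r' < ‖v - v'‖) {s : Fin d → ℤ} (hs : s ∈ sites v r) : s ∉ sites v' r' := by
  intro hs'
  rw [mem_sites] at hs hs'
  refine absurd h (not_lt.2 ((pi_norm_le_iff_of_nonneg hr).2 fun i => ?_))
  obtain ⟨h1, h2⟩ := hs i
  obtain ⟨h3, h4⟩ := hs' i
  rw [Pi.sub_apply, Real.norm_eq_abs, abs_le]
  constructor <;> linarith

variable {Ω : Type*} [MeasurableSpace Ω] {P : Measure Ω} [IsProbabilityMeasure P]
  {U : Config d → ℝ} {V : (Fin d → ℤ) → Ω → ℝ} {φ : (Fin d → ℤ) → (Fin d → ℝ) → ℝ} {R : ℝ}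
  {u u' : Config d} {L L' : Fin 2 → ℝ}

/-- The sites of the far cube do not influence the second level, so the difference inherits
monotonicity and the drop by `η` from the first. -/
theorem measure_level_sub_le (hU : MemLp U ⊤ volume) (hV : ∀ s, Measurable (V s))
    (hφ : BoundedBumps φ) (hc : Covering φ) (hR0 : 0 < R) (hR : FiniteRange φ R)
    (hL' : ∀ j, 1 < L' j) {j : Fin 2} (hL : 1 < L j)
    (hfar : ∀ j', L j + (L' j' + R) < ‖u j - u' j'‖) {k k' : ℕ}
    (hne : (levels (box u L) (potential U φ 0) k).Nonempty)
    (hne' : (levels (box u' L') (potential U φ 0) k').Nonempty) {η : ℝ} (hη : 0 < η) (c : ℝ) :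
    P {ω | level U φ u L k (fun t => V t ω) - level U φ u' L' k' (fun t => V t ω) ∈
      Ioc c (c + η)} ≤ (sites (u j) (L j)).card * (2 * condModulus P V η) := by
  have hout : ∀ s ∈ sites (u j) (L j), ∀ j', s ∉ sites (u' j') (L' j' + R) := fun s hs j' =>
    notMem_sites_of_far (by linarith [hL' j']) (hfar j') hs
  refine measure_Ioc_le hV hη (sites (u j) (L j))
    (Φ := fun a => level U φ u L k a - level U φ u' L' k' a)
    ((continuous_level hU hφ hR hne).sub (continuous_level hU hφ hR hne')).measurable
    (fun s hs a y hy => ?_) (fun a => ?_) c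
  · have h1 : level U φ u' L' k' (Function.update a s y) = level U φ u' L' k' a :=
      level_congr hU hφ hR hne' fun j' t ht => by
        refine Function.update_of_ne ?_ _ _
        rintro rfl
        exact hout _ hs j' ht
    have h2 : level U φ u L k (Function.update a s y) ≤ level U φ u L k a :=
      level_mono hU hφ hR hne (update_le_self_iff.2 hy)
    simp only [h1]
    linarith
  · have h1 : level U φ u' L' k' (lower (sites (u j) (L j)) η a) = level U φ u' L' k' a :=
      level_congr hU hφ hR hne' fun j' t ht => by
        have : t ∉ (sites (u j) (L j) : Set (Fin d → ℤ)) := fun h => hout t h j' ht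
        simp only [lower, indicator_of_notMem this, mul_zero, sub_zero]
    have h2 := level_lower_le hU hφ hR hc hR0 hne hL hη.le a
    simp only [h1]
    linarith

/-- The two-volume estimate in terms of the numbers `N`, `N'` of min-max values below the energies
considered, for a box one of whose projections is far from the other box. -/
theorem measure_setDist_le (hU : MemLp U ⊤ volume) (hV : ∀ s, Measurable (V s))
    (hφ : BoundedBumps φ) (hc : Covering φ) (hR0 : 0 < R) (hR : FiniteRange φ R)
    {M w a b : ℝ} (hM : ∀ᵐ ω ∂P, ∀ s, |V s ω| ≤ M)
    (hw : ∀ (u : Config d) (L : Fin 2 → ℝ) (v : (Fin d → ℤ) → ℝ), (∀ s, |v s| ≤ M) →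
      ∀ᵐ x ∂(volume.restrict (box u L)), -w ≤ potential U φ v x) {N N' : ℕ}
    (hN : ∀ W : Config d → ℝ, MemLp W ⊤ (volume.restrict (box u L)) →
      (∀ᵐ x ∂(volume.restrict (box u L)), -w ≤ W x) →
        ∀ k, ∀ t ∈ levels (box u L) W k, t ≤ b + 1 → k < N)
    (hN' : ∀ W : Config d → ℝ, MemLp W ⊤ (volume.restrict (box u' L')) →
      (∀ᵐ x ∂(volume.restrict (box u' L')), -w ≤ W x) →
        ∀ k, ∀ t ∈ levels (box u' L') W k, t ≤ b + 1 → k < N')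
    (hL' : ∀ j, 1 < L' j) {j : Fin 2} (hL : 1 < L j)
    (hfar : ∀ j', L j + (L' j' + R) < ‖u j - u' j'‖) {ε : ℝ} (hε : 0 < ε) :
    P {ω | setDist (boxSpectrum U φ (fun s => V s ω) (box u L) ∩ Icc a b)
        (boxSpectrum U φ (fun s => V s ω) (box u' L') ∩ Icc a b) ≤ ENNReal.ofReal ε} ≤
      N * (N' * (4 * ((sites (u j) (L j)).card * condModulus P V (2 * ε)))) := by
  -- The nonemptiness conditions do not involve `ω`: a pair of indices that violates them has an
  -- empty event.
  let E : ℕ → ℕ → Set Ω := fun k k' => {ω | (levels (box u L) (potential U φ 0) k).Nonempty ∧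
    (levels (box u' L') (potential U φ 0) k').Nonempty ∧
    |level U φ u L k (fun t => V t ω) - level U φ u' L' k' (fun t => V t ω)| < 2 * ε}
  have hE : ∀ k k', P (E k k') ≤ 4 * ((sites (u j) (L j)).card * condModulus P V (2 * ε)) :=
    fun k k' => by
      by_cases hne : (levels (box u L) (potential U φ 0) k).Nonempty ∧
        (levels (box u' L') (potential U φ 0) k').Nonempty
      · have h := measure_level_sub_le (P := P) hU hV hφ hc hR0 hR hL' hL hfar hne.1 hne.2
          (η := 2 * ε) (by positivity)
        -- The interval `(-2ε, 2ε)` is covered by two half-open intervals of length `2 * ε`, each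
        -- costing `2 |S| ν(2ε)`; hence the factor `4`.
        refine (measure_mono (t := {ω | level U φ u L k (fun t => V t ω) -
            level U φ u' L' k' (fun t => V t ω) ∈ Ioc (-(2 * ε)) (-(2 * ε) + 2 * ε)} ∪
          {ω | level U φ u L k (fun t => V t ω) -
            level U φ u' L' k' (fun t => V t ω) ∈ Ioc 0 (0 + 2 * ε)}) ?_).trans
          ((measure_union_le _ _).trans ((add_le_add (h _) (h _)).trans (le_of_eq (by ring))))
        rintro ω ⟨-, -, hlt⟩
        obtain ⟨h1, h2⟩ := abs_lt.1 hlt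
        rcases le_or_gt (level U φ u L k (fun t => V t ω) -
          level U φ u' L' k' (fun t => V t ω)) 0 with h3 | h3
        · exact Or.inl ⟨h1, by linarith⟩
        · exact Or.inr ⟨h3, by linarith⟩
      · have : E k k' = ∅ := eq_empty_of_forall_notMem fun ω hω => hne ⟨hω.1, hω.2.1⟩
        rw [this]
        simp
  have hsub : ∀ᵐ ω ∂P, ω ∈ {ω | setDist (boxSpectrum U φ (fun s => V s ω) (box u L) ∩ Icc a b)
        (boxSpectrum U φ (fun s => V s ω) (box u' L') ∩ Icc a b) ≤ ENNReal.ofReal ε} →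
      ω ∈ ⋃ k ∈ Finset.range N, ⋃ k' ∈ Finset.range N', E k k' := by
    filter_upwards [hM] with ω hω hd
    obtain ⟨x, ⟨hx, -, hxb⟩, y, ⟨hy, -, hyb⟩, hxy⟩ := exists_abs_sub_lt_of_setDist_le hε hd
    have hW := potential_memLp hU hφ hR u L (fun s => V s ω)
    have hW' := potential_memLp hU hφ hR u' L' (fun s => V s ω)
    obtain ⟨k, hk, hne, rfl⟩ := exists_level_eq_of_mem_spectrum hW (hw u L _ hω)
      (hN _ hW (hw u L _ hω)) hxb hx
    obtain ⟨k', hk', hne', rfl⟩ := exists_level_eq_of_mem_spectrum hW' (hw u' L' _ hω)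
      (hN' _ hW' (hw u' L' _ hω)) hyb hy
    exact mem_iUnion₂.2 ⟨k, Finset.mem_range.2 hk, mem_iUnion₂.2 ⟨k', Finset.mem_range.2 hk',
      levels_nonempty (potential_memLp hU hφ hR u L 0) hW hne,
      levels_nonempty (potential_memLp hU hφ hR u' L' 0) hW' hne', hxy⟩⟩
  calc _ ≤ P (⋃ k ∈ Finset.range N, ⋃ k' ∈ Finset.range N', E k k') := measure_mono_ae hsub
    _ ≤ ∑ k ∈ Finset.range N, P (⋃ k' ∈ Finset.range N', E k k') :=
        measure_biUnion_finset_le _ _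
    _ ≤ ∑ k ∈ Finset.range N, ∑ k' ∈ Finset.range N', P (E k k') :=
        Finset.sum_le_sum fun k _ => measure_biUnion_finset_le _ _
    _ ≤ ∑ k ∈ Finset.range N, ∑ k' ∈ Finset.range N',
          4 * ((sites (u j) (L j)).card * condModulus P V (2 * ε)) :=
        Finset.sum_le_sum fun k _ => Finset.sum_le_sum fun k' _ => hE k k'
    _ = _ := by simp

end TwoVolume

end TwoParticle

/-! ### The two-volume Wegner bound -/

open TwoParticle in
theorem theorem2 {d : ℕ} {Ω : Type*} [MeasurableSpace Ω] (P : Measure Ω) [IsProbabilityMeasure P]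
    (U : TwoParticle.Config d → ℝ) (hU : MemLp U ⊤ volume)
    (V : (Fin d → ℤ) → Ω → ℝ) (hV : ∀ s, Measurable (V s))
    (φ : (Fin d → ℤ) → (Fin d → ℝ) → ℝ)
    (hE0 : TwoParticle.BoundedField P V)
    (hE1 : TwoParticle.BoundedBumps φ)
    (hE2 : TwoParticle.Covering φ)
    (hE3 : TwoParticle.UniformMarginalControl P V)
    (R : ℝ) (hR : 0 < R) (hE4 : TwoParticle.FiniteRange φ R)
    (a b : ℝ) :
    ∃ C : ℝ, 0 < C ∧
      ∀ (u : TwoParticle.Config d) (L : Fin 2 → ℝ) (u' : TwoParticle.Config d) (L' : Fin 2 → ℝ),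
        TwoParticle.SufficientlyDistant R u L u' L' →
        ∀ ε : ℝ, 0 < ε → ε < 1 →
          P {ω | TwoParticle.setDist
                (TwoParticle.boxSpectrum U φ (fun s => V s ω) (TwoParticle.box u L) ∩ Icc a b)
                (TwoParticle.boxSpectrum U φ (fun s => V s ω) (TwoParticle.box u' L') ∩ Icc a b)
              ≤ ENNReal.ofReal ε} ≤
            ENNReal.ofReal C * volume (TwoParticle.box u L) * volume (TwoParticle.box u' L') *
              (⨆ j : Fin 2, max (volume (TwoParticle.proj j (TwoParticle.box u L)))
                (volume (TwoParticle.proj j (TwoParticle.box u' L')))) *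
              TwoParticle.condModulus P V (2 * ε) := by
  obtain ⟨M, hM⟩ := hE0
  obtain ⟨w, hw⟩ := exists_potential_lower_bound hU hE1 hE4 M
  obtain ⟨C, hC, hcount⟩ := exists_level_count d w (b + 1)
  have hM' : ∀ᵐ ω ∂P, ∀ s, |V s ω| ≤ M := ae_all_iff.2 hM
  -- One `C` for the level count of each box, `4` from `measure_setDist_le`, and `2 ^ d` from
  -- counting the sites of a cube.
  refine ⟨C * C * (4 * 2 ^ d), by positivity, fun u L u' L' hfar ε hε _ => ?_⟩
  obtain ⟨N, hN, hNW⟩ := hcount u L hfar.1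
  obtain ⟨N', hN', hNW'⟩ := hcount u' L' hfar.2.1
  have e : ENNReal.ofReal (C * C * (4 * 2 ^ d)) =
      ENNReal.ofReal C * ENNReal.ofReal C * (4 * 2 ^ d) := by
    rw [ENNReal.ofReal_mul (by positivity), ENNReal.ofReal_mul hC.le,
      ENNReal.ofReal_mul (by positivity), ENNReal.ofReal_pow (by positivity),
      ENNReal.ofReal_ofNat, ENNReal.ofReal_ofNat]
  set m := ⨆ j : Fin 2, max (volume (proj j (box u L))) (volume (proj j (box u' L'))) with hm
  set ν := condModulus P V (2 * ε)
  have hfin : ∀ {n : ℕ} {v : ℝ≥0∞}, (n : ℝ≥0∞) ≤ 2 ^ d * v → v ≤ m →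
      (N : ℝ≥0∞) * (N' * (4 * (n * ν))) ≤
        ENNReal.ofReal (C * C * (4 * 2 ^ d)) * volume (box u L) * volume (box u' L') * m * ν :=
    fun {n v} h1 h2 => by
      calc (N : ℝ≥0∞) * (N' * (4 * (n * ν)))
          ≤ (ENNReal.ofReal C * volume (box u L)) * ((ENNReal.ofReal C * volume (box u' L')) *
              (4 * ((2 ^ d * m) * ν))) := by
            gcongr
            exact h1.trans (by gcongr)
        _ = _ := by
            rw [e]
            ring
  rcases hfar.exists_far hR with ⟨j, hj⟩ | ⟨j, hj⟩
  · refine (measure_setDist_le hU hV hE1 hE2 hR hE4 hM' hw hNW hNW' hfar.2.1 (hfar.1 j) hj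
      hε).trans (hfin (card_sites_le (u j) (hfar.1 j)) ?_)
    rw [← proj_box u hfar.1 j]
    exact (le_max_left _ _).trans (le_iSup (fun j : Fin 2 =>
      max (volume (proj j (box u L))) (volume (proj j (box u' L')))) j)
  -- The far projection belongs to the second box, so the estimate is applied with the boxes
  -- exchanged.
  · simp only [setDist_comm (boxSpectrum U φ _ (box u L) ∩ Icc a b)]
    refine (measure_setDist_le hU hV hE1 hE2 hR hE4 hM' hw hNW' hNW hfar.1 (hfar.2.1 j) hj
      hε).trans (le_trans (le_of_eq ?_) (hfin (card_sites_le (u' j) (hfar.2.1 j)) ?_))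
    · ring
    · rw [← proj_box u' hfar.2.1 j]
      exact (le_max_right _ _).trans (le_iSup (fun j : Fin 2 =>
        max (volume (proj j (box u L))) (volume (proj j (box u' L')))) j)
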